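/- Let $\Omega\subset\mathbb R^N$ be open, and let $\{\Phi_j\}_{j\ge1}$ be an orthonormal basis of the real space $L^2(\Omega)$ of eigenfunctions of the Dirichlet Laplacian, $-\Delta\Phi_j=\lambda_j\Phi_j$ in $\Omega$, $\Phi_j=0$ on $\partial\Omega$ (that is, $\Phi_j\in H_0^1(\Omega)$ and $\int_\Omega\nabla\Phi_j\cdot\nabla\psi=\lambda_j\int_\Omega\Phi_j\psi$ for all $\psi\in C_c^\infty(\Omega)$), with $0<\lambda_1\le\lambda_2\le\cdots$ and $\lambda_j\to\infty$. Let $0<s<1$, $0<\alpha<1$, $T>0$. Put $$D((-\Delta)^s)=\Big\{u\in L^2(\Omega):\sum_j\lambda_j^{2s}|(u,\Phi_j)|^2<\infty\Big\},\qquad (-\Delta)^su=\sum_j\lambda_j^s(u,\Phi_j)\Phi_j,\qquad \|u\|_{D((-\Delta)^s)}=\|(-\Delta)^su\|_{L^2(\Omega)},$$ and let $E_{a,b}(z)=\sum_{k\ge0}z^k/\Gamma(ak+b)$. The Caputo derivative is understood as $\partial_t^\alpha u=\frac{d}{dt}\Big[\frac1{\Gamma(1-\alpha)}\int_0^t(t-\tau)^{-\alpha}(u(\tau)-u(0))\,d\tau\Big]$,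 the function in brackets being required to be absolutely continuous on $[0,T]$ (an indefinite Bochner integral of its derivative); for absolutely continuous $u$ this is $\frac1{\Gamma(1-\alpha)}\int_0^t(t-\tau)^{-\alpha}u'(\tau)\,d\tau$. Consider the problem $\partial_t^\alpha u+(-\Delta)^su=F$, $u(0)=u_0$. An a.e. weak solution is a function $u\in C([0,T];L^2(\Omega))\cap L^2(0,T;D((-\Delta)^s))$ with $\partial_t^\alpha u\in L^2(0,T;L^2(\Omega))$, $\partial_t^\alpha u(t)+(-\Delta)^su(t)=F(t)$ in $L^2(\Omega)$ for almost every $t\in(0,T)$, and $\lim_{t\to0^+}\|u(t)-u_0\|=0$. A weak solution is an a.e. weak solution for which in addition $\partial_t^\alpha u\in C((0,T];L^2(\Omega))$ and, for every $t\in(0,T]$, $u(t)\in D((-\Delta)^s)$ and the equation holds. Let $u_0\in D((-\Delta)^s)$ and let $F\in L^\infty(0,T;D((-\Delta)^s))$. Then: 1. There is exactly one a.e. weak solution, and it is given for $t\in[0,T]$ by $$u(t)=\sum_{j}E_{\alpha,1}(-\lambda_j^st^\alpha)(u_0,\Phi_j)\Phi_j+\sum_{j}\Big(\int_0^t(t-\tau)^{\alpha-1}E_{\alpha,\alpha}(-\lambda_j^s(t-\tau)^\alpha)(F(\tau),\Phi_j)\,d\tau\Big)\Phi_j,$$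 where the integrands are integrable and both series converge unconditionally in $L^2(\Omega)$. 2. This $u$ is a weak solution if and only if $F$ (the given function, not its class) is continuous from $(0,T]$ to $L^2(\Omega)$. Every weak solution coincides with $u$ on $[0,T]$. 3. If $F(t)=F(0)+\int_0^tF'(\tau)\,d\tau$ on $[0,T]$ for some $F'\in L^1(0,T;L^2(\Omega))$, then $u$ is differentiable a.e. in $(0,T)$, its derivative $u'$ is in $L^1(0,T;L^2(\Omega))$, $u(t)=u_0+\int_0^tu'(\tau)\,d\tau$ on $[0,T]$, and for every $t\in(0,T]$ the integral below converges absolutely in $L^2(\Omega)$ and $$\frac1{\Gamma(1-\alpha)}\int_0^t(t-\tau)^{-\alpha}u'(\tau)\,d\tau+(-\Delta)^su(t)=F(t).$$ -/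

import Mathlib

open MeasureTheory Set Filter Topology
open scoped ContDiff

noncomputable section

namespace FracDiff

/-- The real Hilbert space `L²(Ω)`. -/
abbrev L2 {N : ℕ} (Ω : Set (EuclideanSpace ℝ (Fin N))) : Type :=
  Lp ℝ 2 (volume.restrict Ω)

/-! ### The Dirichlet Laplacian -/

/-- `ψ ∈ C_c^∞(Ω)`. -/
def IsTestFunction {N : ℕ} (Ω : Set (EuclideanSpace ℝ (Fin N)))
    (ψ : EuclideanSpace ℝ (Fin N) → ℝ) : Prop :=
  ContDiff ℝ ∞ ψ ∧ HasCompactSupport ψ ∧ tsupport ψ ⊆ Ω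

/-- `f ∈ H₀¹(Ω)` (the closure of `C_c^∞(Ω)` in `H¹(Ω)`) and `G = ∇f`. -/
def HasH10Gradient {N : ℕ} (Ω : Set (EuclideanSpace ℝ (Fin N))) (f : L2 Ω)
    (G : Lp (EuclideanSpace ℝ (Fin N)) 2 (volume.restrict Ω)) : Prop :=
  ∃ φ : ℕ → EuclideanSpace ℝ (Fin N) → ℝ, (∀ n, IsTestFunction Ω (φ n)) ∧
    Tendsto (fun n => eLpNorm (fun x => φ n x - f x) 2 (volume.restrict Ω)) atTop (𝓝 0) ∧
    Tendsto (fun n => eLpNorm (fun x => gradient (φ n) x - G x) 2 (volume.restrict Ω))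
      atTop (𝓝 0)

/-- `f` solves `-Δ f = l f` in `Ω`, `f = 0` on `∂Ω` (variational form: `f ∈ H₀¹(Ω)` and
`∫ ∇f · ∇ψ = l ∫ f ψ` for all test functions `ψ`). -/
def IsDirichletEigenfunction {N : ℕ} (Ω : Set (EuclideanSpace ℝ (Fin N))) (l : ℝ)
    (f : L2 Ω) : Prop :=
  ∃ G : Lp (EuclideanSpace ℝ (Fin N)) 2 (volume.restrict Ω), HasH10Gradient Ω f G ∧
    ∀ ψ : EuclideanSpace ℝ (Fin N) → ℝ, IsTestFunction Ω ψ →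
      ∫ x in Ω, inner ℝ (G x) (gradient ψ x) = l * ∫ x in Ω, f x * ψ x

/-- The Hilbert basis `Φ` of `L²(Ω)` consists of eigenfunctions of the Dirichlet Laplacian with
eigenvalues `0 < lam 0 ≤ lam 1 ≤ …`, `lam j → ∞`. -/
structure IsDirichletEigenbasis {N : ℕ} (Ω : Set (EuclideanSpace ℝ (Fin N))) (lam : ℕ → ℝ)
    (Φ : HilbertBasis ℕ ℝ (L2 Ω)) : Prop where
  pos : ∀ j, 0 < lam j
  mono : Monotone lam
  tendsto : Tendsto lam atTop atTop
  eigen : ∀ j, IsDirichletEigenfunction Ω (lam j) (Φ j)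

/-! ### The spectral fractional Laplacian -/

/-- The domain `D((-Δ)^s)`. -/
def fracDomain {N : ℕ} {Ω : Set (EuclideanSpace ℝ (Fin N))} (lam : ℕ → ℝ)
    (Φ : HilbertBasis ℕ ℝ (L2 Ω)) (s : ℝ) : Set (L2 Ω) :=
  {u | Summable fun j => lam j ^ (2 * s) * |inner ℝ u (Φ j)| ^ 2}

/-- `(-Δ)^s u = ∑ λ_j^s (u, Φ_j) Φ_j`, for `u ∈ D((-Δ)^s)`. -/
def fracLaplacian {N : ℕ} {Ω : Set (EuclideanSpace ℝ (Fin N))} (lam : ℕ → ℝ)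
    (Φ : HilbertBasis ℕ ℝ (L2 Ω)) (s : ℝ) (u : L2 Ω) : L2 Ω :=
  ∑' j, (lam j ^ s * inner ℝ u (Φ j)) • Φ j

/-- `f ∈ L^p(0,T; D((-Δ)^s))`, where `D((-Δ)^s)` has the norm `‖u‖ = ‖(-Δ)^s u‖_{L²}`.
As `(-Δ)^s` is an isometry of `D((-Δ)^s)` onto `L²(Ω)`, strong measurability and `p`-integrability
of `f` into `D((-Δ)^s)` are those of `(-Δ)^s f` into `L²(Ω)`. -/
def MemLpDomain {N : ℕ} {Ω : Set (EuclideanSpace ℝ (Fin N))} (lam : ℕ → ℝ)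
    (Φ : HilbertBasis ℕ ℝ (L2 Ω)) (s T : ℝ) (p : ENNReal) (f : ℝ → L2 Ω) : Prop :=
  (∀ᵐ t ∂(volume.restrict (Ioo 0 T)), f t ∈ fracDomain lam Φ s) ∧
    MemLp (fun t => fracLaplacian lam Φ s (f t)) p (volume.restrict (Ioo 0 T))

/-! ### Fractional calculus in time -/

/-- The Mittag-Leffler function `E_{a,b}` on the real line. -/
def mittagLeffler (a b z : ℝ) : ℝ :=
  ∑' k : ℕ, z ^ k / Real.Gamma (a * k + b)

/-- The Riemann-Liouville integral `(I^b f)(t) = Γ(b)⁻¹ ∫₀ᵗ (t-τ)^{b-1} f(τ) dτ`. -/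
def fracIntegral {X : Type*} [NormedAddCommGroup X] [NormedSpace ℝ X] (b : ℝ) (f : ℝ → X)
    (t : ℝ) : X :=
  (Real.Gamma b)⁻¹ • ∫ τ in (0 : ℝ)..t, (t - τ) ^ (b - 1) • f τ

/-- `v` is the Caputo derivative of order `a ∈ (0,1)` of `u` on `[0,T]`, that is,
`v = d/dt I^{1-a}(u - u(0))`: the function `I^{1-a}(u - u(0))` is absolutely continuous on `[0,T]`
with derivative `v`. For absolutely continuous `u` one has `v = I^{1-a} u'`. -/
def HasCaputoDeriv {X : Type*} [NormedAddCommGroup X] [NormedSpace ℝ X] (a T : ℝ)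
    (u v : ℝ → X) : Prop :=
  IntervalIntegrable v volume 0 T ∧
    ∀ t ∈ Icc (0 : ℝ) T, fracIntegral (1 - a) (fun τ => u τ - u 0) t = ∫ τ in (0 : ℝ)..t, v τ

/-- The Caputo derivative as an integral of the classical derivative,
`Γ(1-a)⁻¹ ∫₀ᵗ (t-τ)^{-a} u'(τ) dτ`. -/
def caputoIntegral {X : Type*} [NormedAddCommGroup X] [NormedSpace ℝ X] (a : ℝ) (u : ℝ → X)
    (t : ℝ) : X :=
  (Real.Gamma (1 - a))⁻¹ • ∫ τ in (0 : ℝ)..t, (t - τ) ^ (-a) • deriv u τ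

/-! ### Weak solutions of `∂ₜ^a u + (-Δ)^s u = F`, `u(0) = u₀` -/

/-- Weak solution, the equation holding in `L²(Ω)` at every `t ∈ (0,T]` and the Caputo derivative
being in `C((0,T]; L²(Ω)) ∩ L²(0,T; L²(Ω))`. -/
structure IsWeakSolution {N : ℕ} {Ω : Set (EuclideanSpace ℝ (Fin N))} (lam : ℕ → ℝ)
    (Φ : HilbertBasis ℕ ℝ (L2 Ω)) (s a T : ℝ) (u₀ : L2 Ω) (F u : ℝ → L2 Ω) : Prop where
  continuousOn : ContinuousOn u (Icc 0 T)
  memL2 : MemLpDomain lam Φ s T 2 u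
  equation : ∃ v : ℝ → L2 Ω, HasCaputoDeriv a T u v ∧
    ContinuousOn v (Ioc 0 T) ∧ MemLp v 2 (volume.restrict (Ioo 0 T)) ∧
    ∀ t ∈ Ioc (0 : ℝ) T, u t ∈ fracDomain lam Φ s ∧ v t + fracLaplacian lam Φ s (u t) = F t
  initial : Tendsto (fun t => ‖u t - u₀‖) (𝓝[>] 0) (𝓝 0)

/-- Weak solution in the almost everywhere sense: the equation holds in `L²(Ω)` at almost every
`t ∈ (0,T)` and the Caputo derivative is in `L²(0,T; L²(Ω))`. -/
structure IsWeakSolutionAE {N : ℕ} {Ω : Set (EuclideanSpace ℝ (Fin N))} (lam : ℕ → ℝ)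
    (Φ : HilbertBasis ℕ ℝ (L2 Ω)) (s a T : ℝ) (u₀ : L2 Ω) (F u : ℝ → L2 Ω) : Prop where
  continuousOn : ContinuousOn u (Icc 0 T)
  memL2 : MemLpDomain lam Φ s T 2 u
  equation : ∃ v : ℝ → L2 Ω, HasCaputoDeriv a T u v ∧
    MemLp v 2 (volume.restrict (Ioo 0 T)) ∧
    ∀ᵐ t ∂(volume.restrict (Ioo 0 T)), v t + fracLaplacian lam Φ s (u t) = F t
  initial : Tendsto (fun t => ‖u t - u₀‖) (𝓝[>] 0) (𝓝 0)

/-! ### The eigenfunction series -/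

/-- `E_{a,1}(-λ_j^s t^a) (u₀, Φ_j) Φ_j`. -/
def homTerm {N : ℕ} {Ω : Set (EuclideanSpace ℝ (Fin N))} (lam : ℕ → ℝ)
    (Φ : HilbertBasis ℕ ℝ (L2 Ω)) (s a : ℝ) (u₀ : L2 Ω) (t : ℝ) (j : ℕ) : L2 Ω :=
  (mittagLeffler a 1 (-(lam j ^ s) * t ^ a) * inner ℝ u₀ (Φ j)) • Φ j

/-- `(t-τ)^{a-1} E_{a,a}(-λ_j^s (t-τ)^a) (F(τ), Φ_j)`. -/
def duhamelIntegrand {N : ℕ} {Ω : Set (EuclideanSpace ℝ (Fin N))} (lam : ℕ → ℝ)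
    (Φ : HilbertBasis ℕ ℝ (L2 Ω)) (s a : ℝ) (F : ℝ → L2 Ω) (t : ℝ) (j : ℕ) (τ : ℝ) : ℝ :=
  (t - τ) ^ (a - 1) * mittagLeffler a a (-(lam j ^ s) * (t - τ) ^ a) * inner ℝ (F τ) (Φ j)

/-- `(∫₀ᵗ (t-τ)^{a-1} E_{a,a}(-λ_j^s (t-τ)^a) (F(τ), Φ_j) dτ) Φ_j`. -/
def duhamelTerm {N : ℕ} {Ω : Set (EuclideanSpace ℝ (Fin N))} (lam : ℕ → ℝ)
    (Φ : HilbertBasis ℕ ℝ (L2 Ω)) (s a : ℝ) (F : ℝ → L2 Ω) (t : ℝ) (j : ℕ) : L2 Ω :=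
  (∫ τ in (0 : ℝ)..t, duhamelIntegrand lam Φ s a F t j τ) • Φ j

/-- The eigenfunction series. -/
def seriesSolution {N : ℕ} {Ω : Set (EuclideanSpace ℝ (Fin N))} (lam : ℕ → ℝ)
    (Φ : HilbertBasis ℕ ℝ (L2 Ω)) (s a : ℝ) (u₀ : L2 Ω) (F : ℝ → L2 Ω) (t : ℝ) : L2 Ω :=
  (∑' j, homTerm lam Φ s a u₀ t j) + ∑' j, duhamelTerm lam Φ s a F t j

end FracDiff

end

/-!
In the eigenbasis `Φ` the operator `A = (-Δ)^s` is diagonal with entries `m = λ_j^s > 0`, so the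
problem splits into the scalar equations `∂ₜ^a u + m u = f`, `u(0) = c`. The bound `λ_j ≥ λ_1 > 0`
makes `F` bounded in `L²(Ω)` together with `A F` (`bounded_of_memLpDomain`).

Write `g_b(t) = t^{b-1}/Γ(b)`, `k(t) = t^{a-1} E_{a,a}(-m t^a)`, `e(t) = E_{a,1}(-m t^a)` and `*`
for convolution on `[0,t]`. Termwise integration of the Mittag-Leffler series gives
`g_{1-a} * k = e` and `m (1 * k) = 1 - e` (`conv_rlKernel_relaxKernel_self`,
`conv_one_relaxKernel_self`). With associativity of convolution these two identities yield all
scalar facts: `u = e c + k * f` satisfies `g_{1-a} * (u - c) = 1 * (f - m u)` (`modeSol_caputo`);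
a solution `z` of the homogeneous problem has `g_{1-a} * z = -m (1 * z)`, and convolving with `k`
gives `1 * z = 0` (`eqOn_zero_of_caputo`); and for `f = f(0) + 1 * f'` one has `u = c + 1 * y` and
`g_{1-a} * y + m u = f` with `y = k (f(0) - m c) + k * f'` (`integral_modeDeriv`,
`conv_rlKernel_modeDeriv`).

To sum over the modes one needs the bounds `0 ≤ k ≤ g_a` and `0 ≤ e ≤ 1`, uniform in `m`. They
follow from `E_{a,a}(-x) > 0` for `x ≥ 0` (`mittagLeffler_self_pos`), which is proved from a
Volterra equation whose kernel decreases in time. Thus `k` and `e` define diagonal operators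
`K(t)` and `S(t)` with `‖K(t)‖ ≤ g_a(t)`, `‖S(t)‖ ≤ 1`, strongly continuous on `(0,∞)` and `[0,∞)`
respectively. The series is `u = S u₀ + K * F`, and `A u = S (A u₀) + K * (A F)` is continuous on
`[0,T]` because `A u₀ ∈ L²(Ω)` and `A F` is bounded (`continuousOn_opConv`). Hence the Caputo
derivative `F - A u` is continuous exactly when `F` is. In the absolutely continuous case
`y = K (F(0) - A u₀) + K * F'` is integrable, so `u` is differentiable almost everywhere with
`u' = y`; the bound `‖y‖ ≤ g_a C + g_a * ‖F'‖` together with `g_{1-a} * g_a = 1` makes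
`g_{1-a} * y` converge absolutely at every time.
-/

noncomputable section

namespace FracDiff

/-! ### The Mittag-Leffler function -/

/-- Log-convexity of `Γ` gives `Γ(x+1) ≤ Γ(x+a) (x+a)^{1-a}`, which controls the ratio of
consecutive coefficients of the Mittag-Leffler series. -/
theorem Gamma_div_Gamma_add_le {a x : ℝ} (ha : 0 < a) (ha1 : a < 1) (hx : 0 < x) :
    Real.Gamma x / Real.Gamma (x + a) ≤ (x + a) ^ (1 - a) / x := by
  have hxa : 0 < x + a := by linarith
  have hG := Real.Gamma_pos_of_pos hxa
  have h := Real.Gamma_mul_add_mul_le_rpow_Gamma_mul_rpow_Gamma (s := x + a) (t := x + a + 1)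
    (a := a) (b := 1 - a) hxa (by linarith) ha (by linarith) (by ring)
  have e1 : a * (x + a) + (1 - a) * (x + a + 1) = x + 1 := by ring
  rw [e1, Real.Gamma_add_one hxa.ne', Real.Gamma_add_one hx.ne',
    Real.mul_rpow hxa.le hG.le] at h
  have e2 : Real.Gamma (x + a) ^ a * ((x + a) ^ (1 - a) * Real.Gamma (x + a) ^ (1 - a))
      = (x + a) ^ (1 - a) * Real.Gamma (x + a) := by
    have : Real.Gamma (x + a) ^ a * Real.Gamma (x + a) ^ (1 - a) = Real.Gamma (x + a) := by
      rw [← Real.rpow_add hG]; simp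
    calc _ = (x + a) ^ (1 - a) * (Real.Gamma (x + a) ^ a * Real.Gamma (x + a) ^ (1 - a)) := by ring
      _ = _ := by rw [this]
  rw [e2] at h
  rw [div_le_div_iff₀ hG hx]
  linarith

theorem tendsto_Gamma_div_Gamma_add {a : ℝ} (ha : 0 < a) (ha1 : a < 1) :
    Tendsto (fun x => Real.Gamma x / Real.Gamma (x + a)) atTop (𝓝 0) := by
  have h1 : Tendsto (fun x : ℝ => 2 * (x + a) ^ (-a)) atTop (𝓝 0) := by
    have := ((tendsto_rpow_neg_atTop ha).comp
      (tendsto_atTop_add_const_right atTop a tendsto_id)).const_mul 2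
    simpa using this
  refine squeeze_zero' ?_ ?_ h1
  · filter_upwards [eventually_gt_atTop 0] with x hx
    exact div_nonneg (Real.Gamma_pos_of_pos hx).le (Real.Gamma_pos_of_pos (by linarith)).le
  · filter_upwards [eventually_gt_atTop a] with x hx
    have hx0 : 0 < x := ha.trans hx
    refine (Gamma_div_Gamma_add_le ha ha1 hx0).trans ?_
    rw [div_le_iff₀ hx0, sub_eq_add_neg, Real.rpow_add (by linarith), Real.rpow_one]
    have := Real.rpow_nonneg (show 0 ≤ x + a by linarith) (-a)
    nlinarith

theorem summable_mittagLeffler {a b : ℝ} (ha : 0 < a) (ha1 : a < 1) (hb : 0 < b) (z : ℝ) :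
    Summable fun k : ℕ => z ^ k / Real.Gamma (a * k + b) := by
  rcases eq_or_ne z 0 with rfl | hz
  · refine summable_of_ne_finset_zero (s := {0}) fun k hk => ?_
    simp [show k ≠ 0 by simpa using hk]
  have hpos : ∀ k : ℕ, 0 < a * k + b := fun k => by positivity
  refine summable_of_ratio_test_tendsto_lt_one (l := 0) one_pos
    (Eventually.of_forall fun k => div_ne_zero (pow_ne_zero _ hz)
      (Real.Gamma_pos_of_pos (hpos k)).ne') ?_
  have hlim : Tendsto (fun k : ℕ => a * (k : ℝ) + b) atTop atTop :=
    tendsto_atTop_add_const_right _ _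
      (tendsto_natCast_atTop_atTop.const_mul_atTop ha)
  have := ((tendsto_Gamma_div_Gamma_add ha ha1).comp hlim).const_mul |z|
  rw [mul_zero] at this
  refine this.congr fun k => ?_
  have h1 := Real.Gamma_pos_of_pos (hpos k)
  have h2 := Real.Gamma_pos_of_pos (hpos (k + 1))
  have e : a * (k : ℝ) + b + a = a * ((k + 1 : ℕ) : ℝ) + b := by push_cast; ring
  simp only [Function.comp_apply, e, norm_div, norm_pow, Real.norm_eq_abs, abs_of_pos h1,
    abs_of_pos h2]
  have : |z| ≠ 0 := abs_ne_zero.2 hz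
  field_simp
  ring

theorem continuous_mittagLeffler {a b : ℝ} (ha : 0 < a) (ha1 : a < 1) (hb : 0 < b) :
    Continuous (mittagLeffler a b) := by
  refine continuous_iff_continuousAt.2 fun z => ?_
  have h : ContinuousOn (mittagLeffler a b) (Metric.ball 0 (|z| + 1)) := by
    refine continuousOn_tsum (u := fun k : ℕ => (|z| + 1) ^ k / Real.Gamma (a * k + b))
      (fun k => by fun_prop) (summable_mittagLeffler ha ha1 hb _) fun k x hx => ?_
    have hG := Real.Gamma_pos_of_pos (show 0 < a * k + b by positivity)
    rw [norm_div, norm_pow, Real.norm_of_nonneg hG.le]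
    have : ‖x‖ ≤ |z| + 1 := by simpa using (Metric.mem_ball.1 hx).le
    gcongr
  exact h.continuousAt (Metric.isOpen_ball.mem_nhds (by simp))

theorem mittagLeffler_zero (a b : ℝ) : mittagLeffler a b 0 = (Real.Gamma b)⁻¹ := by
  rw [mittagLeffler, tsum_eq_single 0 fun k hk => by simp [hk]]
  simp

theorem mittagLeffler_eq_add {a b : ℝ} (ha : 0 < a) (ha1 : a < 1) (hb : 0 < b) (z : ℝ) :
    mittagLeffler a b z = (Real.Gamma b)⁻¹ + z * mittagLeffler a (b + a) z := by
  rw [mittagLeffler, (summable_mittagLeffler ha ha1 hb z).tsum_eq_zero_add, mittagLeffler,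
    ← tsum_mul_left]
  congr 1
  · simp
  · refine tsum_congr fun k => ?_
    rw [show a * ((k + 1 : ℕ) : ℝ) + b = a * k + (b + a) by push_cast; ring]
    ring

/-! ### Riemann-Liouville kernels and relaxation kernels -/

/-- Euler's beta integral on `[0,t]`. -/
theorem integral_rpow_mul_rpow {a b t : ℝ} (ha : 0 < a) (hb : 0 < b) (ht : 0 < t) :
    ∫ x in (0 : ℝ)..t, (t - x) ^ (a - 1) * x ^ (b - 1) =
      t ^ (b + a - 1) * (Real.Gamma b * Real.Gamma a / Real.Gamma (b + a)) := by
  have h := Complex.betaIntegral_scaled b a ht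
  have hB : Complex.betaIntegral b a =
      ((Real.Gamma b * Real.Gamma a / Real.Gamma (b + a) : ℝ) : ℂ) := by
    have := Complex.Gamma_mul_Gamma_eq_betaIntegral (s := b) (t := a) (by simpa) (by simpa)
    rw [← Complex.ofReal_add] at this
    simp only [Complex.Gamma_ofReal] at this
    have hG : (Real.Gamma (b + a) : ℂ) ≠ 0 :=
      Complex.ofReal_ne_zero.2 (Real.Gamma_pos_of_pos (by linarith)).ne'
    push_cast
    rw [eq_div_iff hG, mul_comm, this]
  have hI : ∫ x in (0 : ℝ)..t, (x : ℂ) ^ ((b : ℂ) - 1) * ((t : ℂ) - x) ^ ((a : ℂ) - 1) =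
      ((∫ x in (0 : ℝ)..t, (t - x) ^ (a - 1) * x ^ (b - 1) : ℝ) : ℂ) := by
    rw [← intervalIntegral.integral_ofReal]
    refine intervalIntegral.integral_congr fun x hx => ?_
    rw [uIcc_of_le ht.le] at hx
    simp only [Complex.ofReal_mul]
    rw [Complex.ofReal_cpow (by linarith [hx.2]), Complex.ofReal_cpow hx.1]
    push_cast
    ring
  rw [hI, hB] at h
  have e : (t : ℂ) ^ ((b : ℂ) + a - 1) = ((t ^ (b + a - 1) : ℝ) : ℂ) := by
    rw [Complex.ofReal_cpow ht.le]; push_cast; rfl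
  rw [e, ← Complex.ofReal_mul] at h
  exact_mod_cast h

theorem intervalIntegrable_rpow_mul_rpow {a b t : ℝ} (ha : 0 < a) (hb : 0 < b) (ht : 0 < t) :
    IntervalIntegrable (fun x => (t - x) ^ (a - 1) * x ^ (b - 1)) volume 0 t := by
  by_contra h
  have h0 := intervalIntegral.integral_undef h
  rw [integral_rpow_mul_rpow ha hb ht] at h0
  have h1 := Real.Gamma_pos_of_pos ha
  have h2 := Real.Gamma_pos_of_pos hb
  have h3 := Real.Gamma_pos_of_pos (show 0 < b + a by linarith)
  have h4 := Real.rpow_pos_of_pos ht (b + a - 1)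
  have : 0 < t ^ (b + a - 1) * (Real.Gamma b * Real.Gamma a / Real.Gamma (b + a)) := by positivity
  linarith

/-- The kernel `t^{b-1} E_{a,b}(-m t^a)`. For `b = a` it is the resolvent kernel of
`∂ₜ^a u + m u = f`, for `b = 1` it is the solution of `∂ₜ^a u + m u = 0`, `u(0) = 1`. -/
def relaxKernel (a b m t : ℝ) : ℝ := t ^ (b - 1) * mittagLeffler a b (-m * t ^ a)

/-- The kernel `t^{b-1} / Γ(b)` of the Riemann-Liouville integral of order `b`. -/
def rlKernel (b t : ℝ) : ℝ := t ^ (b - 1) / Real.Gamma b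

theorem relaxKernel_eq_tsum {a b m t : ℝ} (ht : 0 < t) :
    relaxKernel a b m t =
      ∑' k : ℕ, (-m) ^ k / Real.Gamma (a * k + b) * t ^ (a * k + b - 1) := by
  rw [relaxKernel, mittagLeffler, ← tsum_mul_left]
  refine tsum_congr fun k => ?_
  rw [mul_pow, ← Real.rpow_mul_natCast ht.le,
    show a * (k : ℝ) + b - 1 = (b - 1) + a * k by ring, Real.rpow_add ht]
  ring

theorem hasSum_relaxKernel {a b t : ℝ} (ha : 0 < a) (ha1 : a < 1) (hb : 0 < b) (m : ℝ)
    (ht : 0 < t) :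
    HasSum (fun k : ℕ => (-m) ^ k / Real.Gamma (a * k + b) * t ^ (a * k + b - 1))
      (relaxKernel a b m t) := by
  have := ((summable_mittagLeffler ha ha1 hb (-m * t ^ a)).mul_left (t ^ (b - 1)))
  rw [relaxKernel_eq_tsum ht]
  refine (this.congr fun k => ?_).hasSum
  rw [mul_pow, ← Real.rpow_mul_natCast ht.le,
    show a * (k : ℝ) + b - 1 = (b - 1) + a * k by ring, Real.rpow_add ht]
  ring

/-- The Riemann-Liouville integral of order `c` maps `t^{b-1} E_{a,b}(-m t^a)` to
`t^{b+c-1} E_{a,b+c}(-m t^a)`: termwise integration of the power series. -/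
theorem integral_rpow_mul_relaxKernel {a b c t : ℝ} (ha : 0 < a) (ha1 : a < 1) (hb : 0 < b)
    (hc : 0 < c) (m : ℝ) (ht : 0 < t) :
    IntervalIntegrable (fun x => (t - x) ^ (c - 1) * relaxKernel a b m x) volume 0 t ∧
    ∫ x in (0 : ℝ)..t, (t - x) ^ (c - 1) * relaxKernel a b m x =
      Real.Gamma c * relaxKernel a (b + c) m t := by
  set f : ℕ → ℝ → ℝ := fun k x =>
    (-m) ^ k / Real.Gamma (a * k + b) * ((t - x) ^ (c - 1) * x ^ (a * k + b - 1)) with hf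
  have hp : ∀ k : ℕ, 0 < a * k + b := fun k => by positivity
  have hfint : ∀ k, Integrable (f k) (volume.restrict (Ioc 0 t)) := fun k =>
    ((intervalIntegrable_iff_integrableOn_Ioc_of_le ht.le).1
      (intervalIntegrable_rpow_mul_rpow hc (hp k) ht)).const_mul _
  have hval : ∀ (n : ℝ) (k : ℕ), ∫ x in Ioc 0 t, n ^ k / Real.Gamma (a * k + b) *
      ((t - x) ^ (c - 1) * x ^ (a * k + b - 1)) =
      Real.Gamma c * (n ^ k / Real.Gamma (a * k + (b + c)) * t ^ (a * k + (b + c) - 1)) := by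
    intro n k
    rw [integral_const_mul, ← intervalIntegral.integral_of_le ht.le,
      integral_rpow_mul_rpow hc (hp k) ht, ← add_assoc]
    have := (Real.Gamma_pos_of_pos (hp k)).ne'
    field_simp
  have hnorm : ∀ k, ∫ x in Ioc 0 t, ‖f k x‖ =
      Real.Gamma c * ((|m|) ^ k / Real.Gamma (a * k + (b + c)) * t ^ (a * k + (b + c) - 1)) := by
    intro k
    rw [← hval]
    refine setIntegral_congr_fun measurableSet_Ioc fun x hx => ?_
    simp only [hf]
    rw [norm_mul, norm_div, norm_pow, norm_neg, Real.norm_eq_abs m,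
      Real.norm_of_nonneg (Real.Gamma_pos_of_pos (hp k)).le, Real.norm_of_nonneg]
    have h1 := Real.rpow_nonneg (sub_nonneg.2 hx.2) (c - 1)
    have h2 := Real.rpow_nonneg hx.1.le (a * k + b - 1)
    positivity
  have hsum : Summable fun k => ∫ x in Ioc 0 t, ‖f k x‖ := by
    simp_rw [hnorm]
    have := (hasSum_relaxKernel ha ha1 (add_pos hb hc) (-|m|) ht).summable
    simp only [neg_neg] at this
    exact this.mul_left _
  have hcongr : ∀ x ∈ Ioc 0 t, ∑' k, f k x = (t - x) ^ (c - 1) * relaxKernel a b m x := by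
    intro x hx
    rw [relaxKernel_eq_tsum hx.1, ← tsum_mul_left]
    refine tsum_congr fun k => ?_
    simp only [hf]; ring
  have hS := hasSum_integral_of_summable_integral_norm hfint hsum
  constructor
  · have hcont : Continuous fun x : ℝ => mittagLeffler a b (-m * x ^ a) :=
      (continuous_mittagLeffler ha ha1 hb).comp
        (continuous_const.mul (Real.continuous_rpow_const ha.le))
    refine ((intervalIntegrable_rpow_mul_rpow hc hb ht).mul_continuousOn
      hcont.continuousOn).congr ?_
    exact fun x _ => by simp only [relaxKernel]; ring
  · rw [intervalIntegral.integral_of_le ht.le, ← setIntegral_congr_fun measurableSet_Ioc hcongr,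
      ← hS.tsum_eq, relaxKernel_eq_tsum ht, ← tsum_mul_left]
    exact tsum_congr fun k => by rw [hf]; exact hval _ k

/-! ### Positivity of the relaxation kernels -/

theorem relaxKernel_eq_sub {a b m t : ℝ} (ha : 0 < a) (ha1 : a < 1) (hb : 0 < b) (ht : 0 < t) :
    relaxKernel a b m t = rlKernel b t - m * relaxKernel a (b + a) m t := by
  rw [relaxKernel, mittagLeffler_eq_add ha ha1 hb, rlKernel, relaxKernel,
    show b + a - 1 = (b - 1) + a by ring, Real.rpow_add ht]
  ring

theorem rpow_mul_rpow_sub_le {a x t₁ t₀ : ℝ} (ha1 : a < 1) (hx : 0 < x) (h1 : x < t₁)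
    (h0 : t₁ < t₀) :
    t₀ ^ (1 - a) * (t₀ - x) ^ (a - 1) ≤ t₁ ^ (1 - a) * (t₁ - x) ^ (a - 1) := by
  have e : ∀ t, x < t → t ^ (1 - a) * (t - x) ^ (a - 1) = (t / (t - x)) ^ (1 - a) := by
    intro t ht
    rw [Real.div_rpow (by linarith) (by linarith), show a - 1 = -(1 - a) by ring,
      Real.rpow_neg (by linarith)]
    rfl
  rw [e _ h1, e _ (h1.trans h0)]
  have p1 : 0 < t₁ - x := by linarith
  have p0 : 0 < t₀ - x := by linarith
  refine Real.rpow_le_rpow (div_nonneg (by linarith) p0.le) ?_ (by linarith)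
  rw [div_le_div_iff₀ p0 p1]
  nlinarith

/-- The Volterra equation for `φ(t) = E_{a,a}(-t^a)`. -/
theorem mittagLeffler_volterra {a t : ℝ} (ha : 0 < a) (ha1 : a < 1) (ht : 0 < t) :
    IntervalIntegrable (fun x => t ^ (1 - a) * (t - x) ^ (a - 1) *
      (x ^ (a - 1) * mittagLeffler a a (-x ^ a))) volume 0 t ∧
    Real.Gamma a * mittagLeffler a a (-t ^ a) =
      1 - ∫ x in (0 : ℝ)..t, t ^ (1 - a) * (t - x) ^ (a - 1) *
        (x ^ (a - 1) * mittagLeffler a a (-x ^ a)) := by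
  obtain ⟨h1, h2⟩ := integral_rpow_mul_relaxKernel ha ha1 ha ha 1 ht
  have e := relaxKernel_eq_sub (m := 1) ha ha1 ha ht
  simp only [relaxKernel, neg_mul, one_mul] at h1 h2 e
  constructor
  · simp only [mul_assoc] at h1 ⊢
    exact h1.const_mul _
  · simp only [mul_assoc] at h2 ⊢
    rw [intervalIntegral.integral_const_mul, h2]
    have hG := (Real.Gamma_pos_of_pos ha).ne'
    have hp : t ^ (1 - a) * t ^ (a - 1) = 1 := by
      rw [← Real.rpow_add ht]; simp
    rw [rlKernel] at e
    calc Real.Gamma a * mittagLeffler a a (-t ^ a)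
        = t ^ (1 - a) * t ^ (a - 1) * (Real.Gamma a * mittagLeffler a a (-t ^ a)) := by
          rw [hp, one_mul]
      _ = t ^ (1 - a) * Real.Gamma a * (t ^ (a - 1) * mittagLeffler a a (-t ^ a)) := by ring
      _ = _ := by
        rw [e]
        field_simp
        rw [mul_sub, hp]
        ring

/-- Positivity of `E_{a,a}` on `(-∞,0]`. The kernel `t^{1-a}(t-x)^{a-1}x^{a-1}` of the Volterra
equation for `φ(t) = E_{a,a}(-t^a)` decreases in `t`, so `φ` cannot drop to zero: at a first zero
`t₀`, comparison with the maximum of `φ` over a short interval `[c, t₀]` gives `φ(t₀) > 0`. -/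
theorem mittagLeffler_self_pos {a t : ℝ} (ha : 0 < a) (ha1 : a < 1) (ht : 0 ≤ t) :
    0 < mittagLeffler a a (-t ^ a) := by
  set φ : ℝ → ℝ := fun t => mittagLeffler a a (-t ^ a) with hφ
  have hφc : Continuous φ :=
    (continuous_mittagLeffler ha ha1 ha).comp (Real.continuous_rpow_const ha.le).neg
  have hG := Real.Gamma_pos_of_pos ha
  by_contra! hneg
  set S : Set ℝ := {t | 0 ≤ t ∧ φ t ≤ 0} with hS
  have hSc : IsClosed S := (isClosed_le continuous_const continuous_id).inter
    (isClosed_le hφc continuous_const)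
  have hSne : S.Nonempty := ⟨t, ht, hneg⟩
  have hSb : BddBelow S := ⟨0, fun x hx => hx.1⟩
  have ht0 := hSc.csInf_mem hSne hSb
  set t₀ := sInf S
  have hφ0 : 0 < φ 0 := by
    simp only [hφ, Real.zero_rpow ha.ne', neg_zero, mittagLeffler_zero]
    positivity
  have ht0pos : 0 < t₀ := lt_of_le_of_ne ht0.1 fun h => by
    have := ht0.2
    rw [← h] at this
    linarith
  have hpos : ∀ x, 0 ≤ x → x < t₀ → 0 < φ x := fun x hx hxt => by
    by_contra! h
    exact absurd (csInf_le hSb ⟨hx, h⟩) (not_le.2 hxt)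
  set w : ℝ → ℝ → ℝ := fun t x => t ^ (1 - a) * (t - x) ^ (a - 1) * x ^ (a - 1) with hw
  have hV : ∀ t, 0 < t → IntervalIntegrable (fun x => w t x * φ x) volume 0 t ∧
      Real.Gamma a * φ t = 1 - ∫ x in (0 : ℝ)..t, w t x * φ x := fun t ht => by
    simpa only [hw, hφ, mul_assoc] using mittagLeffler_volterra ha ha1 ht
  have hwi : IntervalIntegrable (w t₀) volume 0 t₀ := by
    simpa only [hw, mul_assoc] using
      (intervalIntegrable_rpow_mul_rpow ha ha ht0pos).const_mul (t₀ ^ (1 - a))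
  have hw0 : ∀ t x, 0 ≤ x → x ≤ t → 0 ≤ w t x := fun t x hx hxt =>
    mul_nonneg (mul_nonneg (Real.rpow_nonneg (hx.trans hxt) _)
      (Real.rpow_nonneg (sub_nonneg.2 hxt) _)) (Real.rpow_nonneg hx _)
  -- a window before `t₀` on which the kernel has mass less than `Γ(a)`
  obtain ⟨c, hc0, hct, hc⟩ : ∃ c, 0 ≤ c ∧ c < t₀ ∧ ∫ x in c..t₀, w t₀ x < Real.Gamma a := by
    have hcont : ContinuousOn (fun c => ∫ x in c..t₀, w t₀ x) (Icc 0 t₀) := by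
      have := intervalIntegral.continuousOn_primitive_interval_left (f := w t₀) (a := 0) (b := t₀)
        (μ := volume) ?_
      · rwa [uIcc_of_le ht0pos.le] at this
      · rw [uIcc_of_le ht0pos.le, integrableOn_Icc_iff_integrableOn_Ioc]
        exact (intervalIntegrable_iff_integrableOn_Ioc_of_le ht0pos.le).1 hwi
    have hlim := (hcont t₀ ⟨ht0pos.le, le_rfl⟩).mono_left
      (nhdsWithin_mono t₀ (Ioo_subset_Icc_self (a := 0) (b := t₀)))
    simp only [intervalIntegral.integral_same, nhdsWithin_Ioo_eq_nhdsLT ht0pos] at hlim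
    obtain ⟨c, hc1, hc2, hc3⟩ := ((hlim.eventually (gt_mem_nhds hG)).and
      (Ioo_mem_nhdsLT ht0pos)).exists
    exact ⟨c, hc2.le, hc3, hc1⟩
  obtain ⟨t₁, ht1, hmax⟩ := isCompact_Icc.exists_isMaxOn (nonempty_Icc.2 hct.le) hφc.continuousOn
  have hM : 0 < φ t₁ := (hpos c hc0 hct).trans_le (hmax ⟨le_rfl, hct.le⟩)
  have ht1lt : t₁ < t₀ := lt_of_le_of_ne ht1.2 fun h => by
    have := ht0.2
    rw [← h] at this
    linarith
  have ht1pos : 0 ≤ t₁ := hc0.trans ht1.1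
  obtain ⟨hi0, he0⟩ := hV t₀ ht0pos
  have hsub1 : IntervalIntegrable (fun x => w t₀ x * φ x) volume 0 t₁ :=
    hi0.mono_set (by rw [uIcc_of_le ht1pos, uIcc_of_le ht0pos.le]; exact Icc_subset_Icc_right ht1.2)
  have hsub2 : IntervalIntegrable (fun x => w t₀ x * φ x) volume t₁ t₀ :=
    hi0.mono_set (by rw [uIcc_of_le ht1.2, uIcc_of_le ht0pos.le]; exact Icc_subset_Icc_left ht1pos)
  have hwsub : IntervalIntegrable (w t₀) volume t₁ t₀ :=
    hwi.mono_set (by rw [uIcc_of_le ht1.2, uIcc_of_le ht0pos.le]; exact Icc_subset_Icc_left ht1pos)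
  have hwsub' : IntervalIntegrable (w t₀) volume c t₀ :=
    hwi.mono_set (by rw [uIcc_of_le hct.le, uIcc_of_le ht0pos.le]; exact Icc_subset_Icc_left hc0)
  -- the part up to `t₁` is controlled by the equation at `t₁`, since the kernel decreases in time
  have hA : ∫ x in (0 : ℝ)..t₁, w t₀ x * φ x ≤ 1 - Real.Gamma a * φ t₁ := by
    rcases ht1pos.eq_or_lt with h | h
    · rw [← h, intervalIntegral.integral_same]
      simp only [hφ, Real.zero_rpow ha.ne', neg_zero, mittagLeffler_zero]
      rw [mul_inv_cancel₀ hG.ne', sub_self]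
    · obtain ⟨hi1, he1⟩ := hV t₁ h
      rw [he1, sub_sub_cancel]
      refine intervalIntegral.integral_mono_on_of_le_Ioo h.le hsub1 hi1 fun x hx => ?_
      have := rpow_mul_rpow_sub_le ha1 hx.1 hx.2 ht1lt
      exact mul_le_mul_of_nonneg_right (mul_le_mul_of_nonneg_right this
        (Real.rpow_nonneg hx.1.le _)) (hpos x hx.1.le (hx.2.trans ht1lt)).le
  -- the part after `t₁` is less than `Γ(a) φ(t₁)` by the choices of the window and of `t₁`
  have hB : ∫ x in t₁..t₀, w t₀ x * φ x ≤ (∫ x in c..t₀, w t₀ x) * φ t₁ := by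
    calc _ ≤ ∫ x in t₁..t₀, w t₀ x * φ t₁ := by
          refine intervalIntegral.integral_mono_on ht1.2 hsub2 (hwsub.mul_const _) fun x hx => ?_
          exact mul_le_mul_of_nonneg_left (hmax ⟨ht1.1.trans hx.1, hx.2⟩)
            (hw0 _ _ (ht1pos.trans hx.1) hx.2)
      _ = (∫ x in t₁..t₀, w t₀ x) * φ t₁ := intervalIntegral.integral_mul_const _ _
      _ ≤ _ := by
          refine mul_le_mul_of_nonneg_right ?_ hM.le
          refine intervalIntegral.integral_mono_interval ht1.1 ht1.2 le_rfl ?_ hwsub'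
          filter_upwards [ae_restrict_mem measurableSet_Ioc] with x hx
          exact hw0 _ _ (hc0.trans hx.1.le) hx.2
  rw [← intervalIntegral.integral_add_adjacent_intervals hsub1 hsub2] at he0
  have h3 : (∫ x in c..t₀, w t₀ x) * φ t₁ < Real.Gamma a * φ t₁ :=
    mul_lt_mul_of_pos_right hc hM
  have h4 : Real.Gamma a * φ t₀ ≤ 0 := mul_nonpos_of_nonneg_of_nonpos hG.le ht0.2
  linarith

theorem relaxKernel_self_nonneg {a m t : ℝ} (ha : 0 < a) (ha1 : a < 1) (hm : 0 ≤ m) (ht : 0 ≤ t) :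
    0 ≤ relaxKernel a a m t := by
  refine mul_nonneg (Real.rpow_nonneg ht _) ?_
  have h := mittagLeffler_self_pos ha ha1 (t := (m * t ^ a) ^ a⁻¹) (by positivity)
  rw [Real.rpow_inv_rpow (by positivity) ha.ne'] at h
  rw [neg_mul]
  exact h.le

theorem relaxKernel_add_nonneg {a c m t : ℝ} (ha : 0 < a) (ha1 : a < 1) (hc : 0 < c) (hm : 0 ≤ m)
    (ht : 0 < t) : 0 ≤ relaxKernel a (a + c) m t := by
  have h := (integral_rpow_mul_relaxKernel ha ha1 ha hc m ht).2
  have h0 : 0 ≤ ∫ x in (0 : ℝ)..t, (t - x) ^ (c - 1) * relaxKernel a a m x :=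
    intervalIntegral.integral_nonneg ht.le fun x hx =>
      mul_nonneg (Real.rpow_nonneg (sub_nonneg.2 hx.2) _)
        (relaxKernel_self_nonneg ha ha1 hm hx.1)
  rw [h] at h0
  exact nonneg_of_mul_nonneg_right h0 (Real.Gamma_pos_of_pos hc)

theorem relaxKernel_self_le {a m t : ℝ} (ha : 0 < a) (ha1 : a < 1) (hm : 0 ≤ m) (ht : 0 < t) :
    relaxKernel a a m t ≤ rlKernel a t := by
  rw [relaxKernel_eq_sub ha ha1 ha ht]
  have := mul_nonneg hm (relaxKernel_add_nonneg ha ha1 ha hm ht)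
  linarith

theorem rlKernel_nonneg {b t : ℝ} (hb : 0 < b) (ht : 0 ≤ t) : 0 ≤ rlKernel b t :=
  div_nonneg (Real.rpow_nonneg ht _) (Real.Gamma_pos_of_pos hb).le

theorem rlKernel_one (t : ℝ) : rlKernel 1 t = 1 := by simp [rlKernel]

theorem relaxKernel_one (a m t : ℝ) : relaxKernel a 1 m t = mittagLeffler a 1 (-m * t ^ a) := by
  simp [relaxKernel]

theorem relaxKernel_one_mem {a m t : ℝ} (ha : 0 < a) (ha1 : a < 1) (hm : 0 ≤ m) (ht : 0 ≤ t) :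
    relaxKernel a 1 m t ∈ Icc (0 : ℝ) 1 := by
  rcases ht.eq_or_lt with rfl | ht
  · simp [relaxKernel_one, Real.zero_rpow ha.ne', mittagLeffler_zero]
  constructor
  · have := relaxKernel_add_nonneg ha ha1 (c := 1 - a) (by linarith) hm ht
    rwa [add_sub_cancel] at this
  · rw [relaxKernel_eq_sub ha ha1 one_pos ht, rlKernel_one, add_comm 1 a]
    have := mul_nonneg hm (relaxKernel_add_nonneg ha ha1 one_pos hm ht)
    linarith

theorem continuous_relaxKernel_one {a : ℝ} (ha : 0 < a) (ha1 : a < 1) (m : ℝ) :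
    Continuous (relaxKernel a 1 m) := by
  have : relaxKernel a 1 m = fun t => mittagLeffler a 1 (-m * t ^ a) :=
    funext (relaxKernel_one a m)
  rw [this]
  exact (continuous_mittagLeffler ha ha1 one_pos).comp
    (continuous_const.mul (Real.continuous_rpow_const ha.le))

theorem continuousOn_relaxKernel {a b : ℝ} (ha : 0 < a) (ha1 : a < 1) (hb : 0 < b) (m : ℝ) :
    ContinuousOn (relaxKernel a b m) (Ioi 0) := by
  refine ContinuousOn.mul (fun x hx =>
    (Real.continuousAt_rpow_const _ _ (Or.inl (ne_of_gt hx))).continuousWithinAt) ?_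
  exact ((continuous_mittagLeffler ha ha1 hb).comp
    (continuous_const.mul (Real.continuous_rpow_const ha.le))).continuousOn

/-! ### Causal convolution -/

/-- The causal convolution `∫₀ᵗ f(t-τ) g(τ) dτ`. -/
def conv (f g : ℝ → ℝ) (t : ℝ) : ℝ := ∫ τ in (0 : ℝ)..t, f (t - τ) * g τ

theorem conv_comm (f g : ℝ → ℝ) (t : ℝ) : conv f g t = conv g f t := by
  have := intervalIntegral.integral_comp_sub_left (a := 0) (b := t)
    (fun τ => f (t - τ) * g τ) t
  simp only [sub_sub_cancel, sub_self, sub_zero] at this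
  rw [conv, ← this, conv]
  exact intervalIntegral.integral_congr fun x _ => mul_comm _ _

open scoped Convolution in
/-- A convolution over `ℝ` of a function truncated to `(0,T)` with a function vanishing on
`(-∞,0]` is causal. -/
theorem convolution_indicator_left {f h g : ℝ → ℝ} {T t : ℝ} (ht : t ∈ Icc 0 T)
    (h0 : ∀ x ≤ 0, h x = 0) (hg : ∀ x ∈ Ioo 0 T, h x = g x) :
    ((Ioo 0 T).indicator f ⋆[ContinuousLinearMap.mul ℝ ℝ] h) t = conv f g t := by
  rw [conv_comm, conv, convolution_def, intervalIntegral.integral_of_le ht.1,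
    integral_Ioc_eq_integral_Ioo, ← integral_indicator measurableSet_Ioo]
  congr 1 with s
  simp only [indicator, ContinuousLinearMap.mul_apply']
  by_cases hs : s ∈ Ioo 0 t
  · rw [if_pos hs, if_pos ⟨hs.1, hs.2.trans_le ht.2⟩,
      hg _ ⟨by linarith [hs.2], by linarith [hs.1, ht.2]⟩, mul_comm]
  · rw [if_neg hs]
    split_ifs with h'
    · have : t - s ≤ 0 := by
        by_contra! hlt
        exact hs ⟨h'.1, by linarith⟩
      rw [h0 _ this, mul_zero]
    · simp

open scoped Convolution in
theorem convolution_indicator {f g : ℝ → ℝ} {T t : ℝ} (ht : t ≤ T) :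
    ((Ioo 0 T).indicator f ⋆[ContinuousLinearMap.mul ℝ ℝ] (Ioo 0 T).indicator g) t =
      if 0 ≤ t then conv f g t else 0 := by
  split_ifs with h
  · exact convolution_indicator_left ⟨h, ht⟩
      (fun x hx => indicator_of_notMem (fun h => not_lt.2 hx h.1) _)
      (fun x hx => indicator_of_mem hx _)
  · rw [convolution_def]
    refine integral_eq_zero_of_ae (Eventually.of_forall fun s => ?_)
    simp only [indicator, ContinuousLinearMap.mul_apply', Pi.zero_apply]
    split_ifs with h1 h2
    · exact absurd (by linarith [h1.1, h2.1]) h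
    all_goals simp

theorem norm_indicator_eq (f : ℝ → ℝ) (s : Set ℝ) :
    (fun x => ‖s.indicator f x‖) = s.indicator (fun x => |f x|) := by
  ext x
  rw [norm_indicator_eq_indicator_norm]
  rfl

/-- The convolution of functions integrable on `(0,T)` is integrable on `(0,T)`. -/
theorem integrableOn_conv {f g : ℝ → ℝ} {T : ℝ} (hf : IntegrableOn f (Ioo 0 T))
    (hg : IntegrableOn g (Ioo 0 T)) : IntegrableOn (conv f g) (Ioo 0 T) := by
  rw [← integrable_indicator_iff measurableSet_Ioo] at hf hg
  have h := (hf.integrable_convolution (ContinuousLinearMap.mul ℝ ℝ) hg).integrableOn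
    (s := Ioo 0 T)
  refine (integrableOn_congr_fun (fun t ht => ?_) measurableSet_Ioo).1 h
  rw [convolution_indicator ht.2.le, if_pos ht.1.le]

/-- For functions integrable on `(0,T)` the integrand of the convolution is integrable for almost
every `t`. -/
theorem ae_intervalIntegrable_conv {f g : ℝ → ℝ} {T : ℝ} (hf : IntegrableOn f (Ioo 0 T))
    (hg : IntegrableOn g (Ioo 0 T)) :
    ∀ᵐ t ∂(volume.restrict (Ioo 0 T)),
      IntervalIntegrable (fun τ => f (t - τ) * g τ) volume 0 t := by
  rw [← integrable_indicator_iff measurableSet_Ioo] at hf hg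
  have h := hg.ae_convolution_exists (ContinuousLinearMap.mul ℝ ℝ) hf
  filter_upwards [ae_restrict_of_ae h, ae_restrict_mem measurableSet_Ioo] with t ht htT
  rw [intervalIntegrable_iff_integrableOn_Ioo_of_le htT.1.le]
  refine (integrableOn_congr_fun (fun s hs => ?_) measurableSet_Ioo).1
    (Integrable.integrableOn ht (s := Ioo 0 t))
  simp only [ContinuousLinearMap.mul_apply']
  rw [indicator_of_mem (show s ∈ Ioo 0 T from ⟨hs.1, hs.2.trans htT.2⟩),
    indicator_of_mem (show t - s ∈ Ioo 0 T from ⟨by linarith [hs.2], by linarith [hs.1, htT.2]⟩),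
    mul_comm]

open scoped Convolution in
/-- Associativity of causal convolution at every point of `[0,T]`, with integrability of the outer
integrand, if `|f| * |g|` is bounded. By Tonelli, the integral of
`|f(s)| |g(t-s-r)| |k(r)|` is at most `M ∫ |k|`. -/
theorem conv_assoc {f g k : ℝ → ℝ} {T M t : ℝ} (hf : IntegrableOn f (Ioo 0 T))
    (hg : IntegrableOn g (Ioo 0 T)) (hk : IntegrableOn k (Ioo 0 T))
    (hM : ∀ x ∈ Ioo 0 T, conv (fun x => |f x|) (fun x => |g x|) x ≤ M) (ht : t ∈ Icc 0 T) :
    IntervalIntegrable (fun τ => f (t - τ) * conv g k τ) volume 0 t ∧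
      conv f (conv g k) t = conv (conv f g) k t := by
  set L := ContinuousLinearMap.mul ℝ ℝ with hL
  set f' := (Ioo 0 T).indicator f with hf'
  set g' := (Ioo 0 T).indicator g with hg'
  set k' := (Ioo 0 T).indicator k with hk'
  have If : Integrable f' := (integrable_indicator_iff measurableSet_Ioo).2 hf
  have Ig : Integrable g' := (integrable_indicator_iff measurableSet_Ioo).2 hg
  have Ik : Integrable k' := (integrable_indicator_iff measurableSet_Ioo).2 hk
  have qmp : Measure.QuasiMeasurePreserving (fun r : ℝ => t - r) volume volume :=
    quasiMeasurePreserving_sub_left_of_right_invariant volume t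
  have hmeas : AEStronglyMeasurable
      (fun p : ℝ × ℝ => ‖f' p.1‖ * ‖g' (t - p.1 - p.2)‖ * ‖k' p.2‖) (volume.prod volume) := by
    refine (If.1.comp_fst.norm.mul ?_).mul Ik.1.comp_snd.norm
    refine AEStronglyMeasurable.norm ?_
    refine Ig.1.comp_quasiMeasurePreserving (f := fun p : ℝ × ℝ => t - p.1 - p.2) ?_
    exact QuasiMeasurePreserving.prod_of_right (by fun_prop) (Eventually.of_forall fun x =>
      quasiMeasurePreserving_sub_left_of_right_invariant volume (t - x))
  -- for fixed `r` the integral over `s` is `(|f| * |g|)(t-r) |k(r)|`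
  have hbound : ∀ r, (∫ s, ‖‖f' s‖ * ‖g' (t - s - r)‖ * ‖k' r‖‖) ≤ max M 0 * ‖k' r‖ := by
    intro r
    have e : (fun s => ‖‖f' s‖ * ‖g' (t - s - r)‖ * ‖k' r‖‖) =
        fun s => (‖f' s‖ * ‖g' (t - r - s)‖) * ‖k' r‖ := by
      ext s
      rw [Real.norm_of_nonneg (by positivity), sub_right_comm]
    rw [e, integral_mul_const]
    by_cases hr : r ∈ Ioo 0 T
    · refine mul_le_mul_of_nonneg_right ?_ (norm_nonneg _)
      have h1 := convolution_indicator (f := fun x => |f x|) (g := fun x => |g x|)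
        (show t - r ≤ T by linarith [hr.1, ht.2])
      rw [← norm_indicator_eq, ← norm_indicator_eq] at h1
      have h2 : ∫ s, ‖f' s‖ * ‖g' (t - r - s)‖ =
        if 0 ≤ t - r then conv (fun x => |f x|) (fun x => |g x|) (t - r) else 0 := h1
      rw [h2]
      split_ifs with h
      · rcases h.eq_or_lt with h0 | h0
        · rw [← h0]; simp [conv]
        · exact (hM _ ⟨h0, by linarith [hr.1, ht.2]⟩).trans (le_max_left _ _)
      · exact le_max_right _ _
    · rw [hk', indicator_of_notMem hr]; simp
  have hprod : Integrable (fun p : ℝ × ℝ => ‖f' p.1‖ * ‖g' (t - p.1 - p.2)‖ * ‖k' p.2‖)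
      (volume.prod volume) := by
    rw [integrable_prod_iff' hmeas]
    constructor
    · have := qmp.ae (If.norm.ae_convolution_exists L Ig.norm)
      filter_upwards [this] with r hr
      refine (Integrable.mul_const hr ‖k' r‖).congr (Eventually.of_forall fun s => ?_)
      simp only [hL, ContinuousLinearMap.mul_apply']
      rw [sub_right_comm]
    · refine (Ik.norm.const_mul (max M 0)).mono' hmeas.prod_swap.norm.integral_prod_right'
        (Eventually.of_forall fun r => ?_)
      rw [Real.norm_of_nonneg (integral_nonneg fun _ => norm_nonneg _)]
      exact hbound r
  -- integrating out `r` turns the triple product into `|f(s)| (|g| * |k|)(t-s)`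
  have hfgk : ConvolutionExistsAt (fun x => ‖f' x‖)
      ((fun x => ‖g' x‖) ⋆[L, volume] fun x => ‖k' x‖) t L volume := by
    refine hprod.integral_prod_left.congr (Eventually.of_forall fun s => ?_)
    simp only [hL, ContinuousLinearMap.mul_apply', mul_assoc]
    rw [integral_const_mul]
    congr 1
    rw [convolution_mul_swap]
  have hassoc := convolution_assoc L L L L (fun x y z => by simp [hL, mul_assoc]) (x₀ := t)
    If.1 Ig.1 Ik.1 (If.ae_convolution_exists L Ig) (Ig.norm.ae_convolution_exists L Ik.norm) hfgk
  have h0 : ∀ x ≤ 0, (g' ⋆[L, volume] k') x = 0 := fun x hx => by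
    rw [convolution_indicator (hx.trans (ht.1.trans ht.2))]
    split_ifs with h
    · rw [le_antisymm hx h]; simp [conv]
    · rfl
  have h1 : ∀ x ∈ Ioo 0 T, (g' ⋆[L, volume] k') x = conv g k x := fun x hx => by
    rw [convolution_indicator hx.2.le, if_pos hx.1.le]
  constructor
  · have hgk := Ig.integrable_convolution L Ik
    have hi : Integrable fun s => f' s * (g' ⋆[L, volume] k') (t - s) := by
      refine Integrable.mono' hfgk
        (If.1.mul (hgk.1.comp_quasiMeasurePreserving qmp)) (Eventually.of_forall fun s => ?_)
      simp only [hL, ContinuousLinearMap.mul_apply', norm_mul]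
      refine mul_le_mul_of_nonneg_left ?_ (norm_nonneg _)
      rw [convolution_def, convolution_def]
      refine (norm_integral_le_integral_norm _).trans (le_of_eq ?_)
      simp
    have hi' := (hi.comp_sub_left t).integrableOn (s := Ioo 0 t)
    rw [intervalIntegrable_iff_integrableOn_Ioo_of_le ht.1]
    refine (integrableOn_congr_fun (fun s hs => ?_) measurableSet_Ioo).1 hi'
    simp only [sub_sub_cancel]
    rw [h1 s ⟨hs.1, hs.2.trans_le ht.2⟩, hf', indicator_of_mem (show t - s ∈ Ioo 0 T from
      ⟨by linarith [hs.2], by linarith [hs.1, ht.2]⟩)]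
  · rw [← convolution_indicator_left ht h0 h1, ← hassoc, conv_comm (conv f g) k,
      ← convolution_indicator_left (f := k) (h := f' ⋆[L, volume] g') (g := conv f g) ht ?_ ?_,
      convolution_mul_swap]
    · rw [convolution_def]
      refine integral_congr_ae (Eventually.of_forall fun s => ?_)
      simp only [hL, ContinuousLinearMap.mul_apply', mul_comm]
      rfl
    · intro x hx
      rw [convolution_indicator (hx.trans (ht.1.trans ht.2))]
      split_ifs with h
      · rw [le_antisymm hx h]; simp [conv]
      · rfl
    · intro x hx
      rw [convolution_indicator hx.2.le, if_pos hx.1.le]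

theorem conv_congr {f f' g g' : ℝ → ℝ} {t : ℝ} (ht : 0 ≤ t) (h : ∀ x ∈ Ioo 0 t, f x = f' x)
    (h' : ∀ x ∈ Ioo 0 t, g x = g' x) : conv f g t = conv f' g' t := by
  rw [conv, conv, intervalIntegral.integral_of_le ht, intervalIntegral.integral_of_le ht,
    integral_Ioc_eq_integral_Ioo, integral_Ioc_eq_integral_Ioo]
  refine setIntegral_congr_fun measurableSet_Ioo fun x hx => ?_
  rw [h _ ⟨by linarith [hx.2], by linarith [hx.1]⟩, h' _ hx]

theorem conv_const_one (f : ℝ → ℝ) (t : ℝ) : conv (fun _ => 1) f t = ∫ τ in (0 : ℝ)..t, f τ := by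
  simp [conv]

theorem intervalIntegrable_of_integrableOn_Ioo {E : Type*} [NormedAddCommGroup E] {f : ℝ → E}
    {T t : ℝ} (hf : IntegrableOn f (Ioo 0 T)) (ht : t ∈ Icc 0 T) :
    IntervalIntegrable f volume 0 t :=
  (intervalIntegrable_iff_integrableOn_Ioo_of_le ht.1).2
    (hf.mono_set (Ioo_subset_Ioo_right ht.2))

theorem intervalIntegrable_conv_continuous {f g : ℝ → ℝ} {T t : ℝ} (hf : Continuous f)
    (hg : IntegrableOn g (Ioo 0 T)) (ht : t ∈ Icc 0 T) :
    IntervalIntegrable (fun τ => f (t - τ) * g τ) volume 0 t :=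
  (intervalIntegrable_of_integrableOn_Ioo hg ht).continuousOn_mul
    (hf.comp (continuous_const.sub continuous_id)).continuousOn

/-! ### Convolution identities for the kernels -/

theorem integrableOn_rlKernel {b : ℝ} (hb : 0 < b) (T : ℝ) :
    IntegrableOn (rlKernel b) (Ioo 0 T) := by
  rcases le_or_gt T 0 with hT | hT
  · simp [Ioo_eq_empty_of_le hT]
  · refine Integrable.div_const ?_ _
    exact (intervalIntegrable_iff_integrableOn_Ioo_of_le hT.le).1
      (intervalIntegral.intervalIntegrable_rpow' (by linarith))

theorem integrableOn_relaxKernel {a b : ℝ} (ha : 0 < a) (ha1 : a < 1) (hb : 0 < b) (m T : ℝ) :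
    IntegrableOn (relaxKernel a b m) (Ioo 0 T) := by
  rcases le_or_gt T 0 with hT | hT
  · simp [Ioo_eq_empty_of_le hT]
  · refine (intervalIntegrable_iff_integrableOn_Ioo_of_le hT.le).1 ?_
    refine IntervalIntegrable.mul_continuousOn
      (intervalIntegral.intervalIntegrable_rpow' (by linarith)) ?_
    exact ((continuous_mittagLeffler ha ha1 hb).comp
      (continuous_const.mul (Real.continuous_rpow_const ha.le))).continuousOn

theorem relaxKernel_zero (a b t : ℝ) : relaxKernel a b 0 t = rlKernel b t := by
  rw [relaxKernel, neg_zero, zero_mul, mittagLeffler_zero, rlKernel, div_eq_mul_inv]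

theorem conv_rlKernel_relaxKernel {a b c t : ℝ} (ha : 0 < a) (ha1 : a < 1) (hb : 0 < b)
    (hc : 0 < c) (m : ℝ) (ht : 0 < t) :
    conv (rlKernel c) (relaxKernel a b m) t = relaxKernel a (b + c) m t := by
  have h := (integral_rpow_mul_relaxKernel ha ha1 hb hc m ht).2
  have hG := (Real.Gamma_pos_of_pos hc).ne'
  rw [conv]
  simp only [rlKernel, div_mul_eq_mul_div]
  rw [intervalIntegral.integral_div, h]
  field_simp

theorem intervalIntegrable_rlKernel_relaxKernel {a b c t : ℝ} (ha : 0 < a) (ha1 : a < 1)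
    (hb : 0 < b) (hc : 0 < c) (m : ℝ) (ht : 0 ≤ t) :
    IntervalIntegrable (fun τ => rlKernel c (t - τ) * relaxKernel a b m τ) volume 0 t := by
  rcases ht.eq_or_lt with rfl | ht
  · exact IntervalIntegrable.refl
  simp only [rlKernel, div_mul_eq_mul_div]
  exact (integral_rpow_mul_relaxKernel ha ha1 hb hc m ht).1.div_const _

/-- `g * k = e`, where `g` is the Riemann-Liouville kernel of order `1-a`. -/
theorem conv_rlKernel_relaxKernel_self {a t : ℝ} (ha : 0 < a) (ha1 : a < 1) (m : ℝ) (ht : 0 < t) :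
    conv (rlKernel (1 - a)) (relaxKernel a a m) t = relaxKernel a 1 m t := by
  rw [conv_rlKernel_relaxKernel ha ha1 ha (by linarith) m ht, add_sub_cancel]

/-- `m (1 * k) = 1 - e`. -/
theorem conv_one_relaxKernel_self {a t : ℝ} (ha : 0 < a) (ha1 : a < 1) (m : ℝ) (ht : 0 ≤ t) :
    m * conv (fun _ => 1) (relaxKernel a a m) t = 1 - relaxKernel a 1 m t := by
  rcases ht.eq_or_lt with rfl | ht
  · simp [conv, relaxKernel_one, Real.zero_rpow ha.ne', mittagLeffler_zero]
  have h := conv_rlKernel_relaxKernel ha ha1 ha one_pos m ht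
  rw [funext rlKernel_one] at h
  rw [h, relaxKernel_eq_sub ha ha1 one_pos ht, rlKernel_one, add_comm 1 a]
  ring

/-- The Caputo equation for `e(t) = E_{a,1}(-m t^a)`, integrated in time. -/
theorem conv_rlKernel_relaxKernel_one_sub {a t : ℝ} (ha : 0 < a) (ha1 : a < 1) (m : ℝ)
    (ht : 0 ≤ t) :
    conv (rlKernel (1 - a)) (fun τ => relaxKernel a 1 m τ - 1) t =
      -(m * ∫ τ in (0 : ℝ)..t, relaxKernel a 1 m τ) := by
  rcases ht.eq_or_lt with rfl | ht
  · simp [conv]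
  have hb : 0 < 1 - a := by linarith
  have h1 := conv_rlKernel_relaxKernel ha ha1 one_pos hb m ht
  have h2 := conv_rlKernel_relaxKernel ha ha1 one_pos hb 0 ht
  have h3 := conv_rlKernel_relaxKernel ha ha1 one_pos one_pos m ht
  rw [funext rlKernel_one, conv_const_one] at h3
  rw [relaxKernel_zero] at h2
  have h4 := relaxKernel_eq_sub (m := m) (b := 1 + (1 - a)) ha ha1 (by linarith) ht
  rw [show 1 + (1 - a) + a = (1 : ℝ) + 1 by ring, ← h3, ← h1, ← h2] at h4
  have e : conv (rlKernel (1 - a)) (fun τ => relaxKernel a 1 m τ - 1) t =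
      conv (rlKernel (1 - a)) (relaxKernel a 1 m) t -
        conv (rlKernel (1 - a)) (relaxKernel a 1 0) t := by
    rw [conv, conv, conv, ← intervalIntegral.integral_sub
      (intervalIntegrable_rlKernel_relaxKernel ha ha1 one_pos hb m ht.le)
      (intervalIntegrable_rlKernel_relaxKernel ha ha1 one_pos hb 0 ht.le)]
    refine intervalIntegral.integral_congr fun x _ => ?_
    simp only [relaxKernel_zero, rlKernel_one]
    ring
  rw [e]
  linarith

theorem conv_abs_rlKernel_le {a m t : ℝ} (ha : 0 < a) (ha1 : a < 1) (hm : 0 ≤ m) (ht : 0 < t) :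
    conv (fun x => |rlKernel (1 - a) x|) (fun x => |relaxKernel a a m x|) t ≤ 1 := by
  rw [conv_congr (f' := rlKernel (1 - a)) (g' := relaxKernel a a m) ht.le
    (fun x hx => abs_of_nonneg (rlKernel_nonneg (by linarith) hx.1.le))
    (fun x hx => abs_of_nonneg (relaxKernel_self_nonneg ha ha1 hm hx.1.le)),
    conv_rlKernel_relaxKernel_self ha ha1 m ht]
  exact (relaxKernel_one_mem ha ha1 hm ht.le).2

theorem integral_rlKernel {a t : ℝ} (ha : 0 < a) :
    ∫ τ in (0 : ℝ)..t, rlKernel a τ = t ^ a / (a * Real.Gamma a) := by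
  simp only [rlKernel]
  rw [intervalIntegral.integral_div, integral_rpow (Or.inl (by linarith))]
  rw [sub_add_cancel, Real.zero_rpow ha.ne', sub_zero, div_div]

theorem conv_abs_one_le {a m t T : ℝ} (ha : 0 < a) (ha1 : a < 1) (hm : 0 ≤ m)
    (ht : t ∈ Ioo 0 T) :
    conv (fun _ => |(1 : ℝ)|) (fun x => |relaxKernel a a m x|) t ≤
      T ^ a / (a * Real.Gamma a) := by
  have hG := Real.Gamma_pos_of_pos ha
  rw [abs_one, conv_const_one]
  have h1 : ∫ x in (0 : ℝ)..t, |relaxKernel a a m x| ≤ ∫ x in (0 : ℝ)..t, rlKernel a x := by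
    refine intervalIntegral.integral_mono_on_of_le_Ioo ht.1.le
      (intervalIntegrable_of_integrableOn_Ioo (integrableOn_relaxKernel ha ha1 ha m T).abs
        (Ioo_subset_Icc_self ht))
      (intervalIntegrable_of_integrableOn_Ioo (integrableOn_rlKernel ha T)
        (Ioo_subset_Icc_self ht)) fun x hx => ?_
    rw [abs_of_nonneg (relaxKernel_self_nonneg ha ha1 hm hx.1.le)]
    exact relaxKernel_self_le ha ha1 hm hx.1
  refine h1.trans ?_
  rw [integral_rlKernel ha]
  have := ht.1.le
  have := ht.2.le
  gcongr

theorem integrableOn_one (T : ℝ) : IntegrableOn (fun _ : ℝ => (1 : ℝ)) (Ioo 0 T) :=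
  integrableOn_const (by simp)

/-- Applying the Riemann-Liouville kernel of order `1-a` to `k * f` gives `e * f`, where
`k(t) = t^{a-1} E_{a,a}(-m t^a)` and `e(t) = E_{a,1}(-m t^a)`. -/
theorem conv_rlKernel_conv {a m T t : ℝ} {f : ℝ → ℝ} (ha : 0 < a) (ha1 : a < 1) (hm : 0 ≤ m)
    (hf : IntegrableOn f (Ioo 0 T)) (ht : t ∈ Icc 0 T) :
    IntervalIntegrable (fun τ => rlKernel (1 - a) (t - τ) * conv (relaxKernel a a m) f τ)
      volume 0 t ∧
    conv (rlKernel (1 - a)) (conv (relaxKernel a a m) f) t = conv (relaxKernel a 1 m) f t := by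
  obtain ⟨h1, h2⟩ := conv_assoc (integrableOn_rlKernel (by linarith) T)
    (integrableOn_relaxKernel ha ha1 ha m T) hf
    (fun x hx => conv_abs_rlKernel_le ha ha1 hm hx.1) ht
  refine ⟨h1, h2.trans (conv_congr ht.1 (fun x hx => ?_) fun _ _ => rfl)⟩
  exact conv_rlKernel_relaxKernel_self ha ha1 m hx.1

/-- `1 * (k * f) = (1 * k) * f`. -/
theorem conv_one_conv {a m T t : ℝ} {f : ℝ → ℝ} (ha : 0 < a) (ha1 : a < 1) (hm : 0 ≤ m)
    (hf : IntegrableOn f (Ioo 0 T)) (ht : t ∈ Icc 0 T) :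
    IntervalIntegrable (conv (relaxKernel a a m) f) volume 0 t ∧
    ∫ τ in (0 : ℝ)..t, conv (relaxKernel a a m) f τ =
      conv (conv (fun _ => 1) (relaxKernel a a m)) f t := by
  obtain ⟨h1, h2⟩ := conv_assoc (integrableOn_one T)
    (integrableOn_relaxKernel ha ha1 ha m T) hf
    (fun x hx => conv_abs_one_le ha ha1 hm hx) ht
  rw [conv_const_one] at h2
  exact ⟨by simpa using h1, h2⟩

/-- `k * (1 * f) = (1 * k) * f`, where `1 * f` is the primitive of `f`. -/
theorem conv_conv_one {a m T t : ℝ} {f : ℝ → ℝ} (ha : 0 < a) (ha1 : a < 1) (hm : 0 ≤ m)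
    (hf : IntegrableOn f (Ioo 0 T)) (ht : t ∈ Icc 0 T) :
    IntervalIntegrable (fun τ => relaxKernel a a m (t - τ) * ∫ σ in (0 : ℝ)..τ, f σ) volume 0 t ∧
    conv (relaxKernel a a m) (fun τ => ∫ σ in (0 : ℝ)..τ, f σ) t =
      conv (conv (fun _ => 1) (relaxKernel a a m)) f t := by
  obtain ⟨h1, h2⟩ := conv_assoc (M := T ^ a / (a * Real.Gamma a))
    (integrableOn_relaxKernel ha ha1 ha m T) (integrableOn_one T) hf
    (fun x hx => by rw [conv_comm]; exact conv_abs_one_le ha ha1 hm hx) ht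
  have e : (conv (relaxKernel a a m) fun _ => 1) = conv (fun _ => 1) (relaxKernel a a m) :=
    funext fun x => conv_comm _ _ _
  have e' : (conv (fun _ => 1) f) = fun τ => ∫ σ in (0 : ℝ)..τ, f σ :=
    funext (conv_const_one f)
  rw [e, e'] at h2
  rw [e'] at h1
  exact ⟨h1, h2⟩

/-- `m (1 * k) * f = 1 * f - e * f`. -/
theorem mul_conv_one_conv {a m T t : ℝ} {f : ℝ → ℝ} (ha : 0 < a) (ha1 : a < 1)
    (hf : IntegrableOn f (Ioo 0 T)) (ht : t ∈ Icc 0 T) :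
    m * conv (conv (fun _ => 1) (relaxKernel a a m)) f t =
      (∫ τ in (0 : ℝ)..t, f τ) - conv (relaxKernel a 1 m) f t := by
  rw [conv, ← intervalIntegral.integral_const_mul, conv, ← intervalIntegral.integral_sub
    (intervalIntegrable_of_integrableOn_Ioo hf ht)
    (intervalIntegrable_conv_continuous (continuous_relaxKernel_one ha ha1 m) hf ht)]
  refine intervalIntegral.integral_congr fun x hx => ?_
  rw [uIcc_of_le ht.1] at hx
  rw [← mul_assoc, conv_one_relaxKernel_self ha ha1 m (sub_nonneg.2 hx.2)]
  ring

/-! ### The scalar equation `∂ₜ^a u + m u = f` -/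

/-- The mode `u(t) = E_{a,1}(-m t^a) c + ∫₀ᵗ (t-τ)^{a-1} E_{a,a}(-m (t-τ)^a) f(τ) dτ`. -/
def modeSol (a m c : ℝ) (f : ℝ → ℝ) (t : ℝ) : ℝ :=
  relaxKernel a 1 m t * c + conv (relaxKernel a a m) f t

theorem modeSol_zero {a : ℝ} (ha : 0 < a) (m c : ℝ) (f : ℝ → ℝ) : modeSol a m c f 0 = c := by
  simp [modeSol, conv, relaxKernel_one, Real.zero_rpow ha.ne', mittagLeffler_zero]

/-- The mode solves the scalar equation, integrated in time. -/
theorem modeSol_caputo {a m T t : ℝ} {f : ℝ → ℝ} (c : ℝ) (ha : 0 < a) (ha1 : a < 1) (hm : 0 ≤ m)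
    (hf : IntegrableOn f (Ioo 0 T)) (ht : t ∈ Icc 0 T) :
    conv (rlKernel (1 - a)) (fun τ => modeSol a m c f τ - c) t =
      ∫ τ in (0 : ℝ)..t, (f τ - m * modeSol a m c f τ) := by
  obtain ⟨h1, h2⟩ := conv_rlKernel_conv ha ha1 hm hf ht
  obtain ⟨h3, h4⟩ := conv_one_conv ha ha1 hm hf ht
  have h5 := mul_conv_one_conv (m := m) ha ha1 hf ht
  have h6 := conv_rlKernel_relaxKernel_one_sub ha ha1 m ht.1
  have hb : 0 < 1 - a := by linarith
  have hi : IntervalIntegrable (fun τ => rlKernel (1 - a) (t - τ) * (relaxKernel a 1 m τ - 1))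
      volume 0 t := by
    refine ((intervalIntegrable_rlKernel_relaxKernel ha ha1 one_pos hb m ht.1).sub
      (intervalIntegrable_rlKernel_relaxKernel ha ha1 one_pos hb 0 ht.1)).congr fun x _ => ?_
    simp only [relaxKernel_zero, rlKernel_one]
    ring
  have hL : conv (rlKernel (1 - a)) (fun τ => modeSol a m c f τ - c) t =
      c * conv (rlKernel (1 - a)) (fun τ => relaxKernel a 1 m τ - 1) t +
        conv (rlKernel (1 - a)) (conv (relaxKernel a a m) f) t := by
    rw [conv, conv, conv, ← intervalIntegral.integral_const_mul,
      ← intervalIntegral.integral_add (hi.const_mul c) h1]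
    refine intervalIntegral.integral_congr fun x _ => ?_
    simp only [modeSol]
    ring
  have he : IntervalIntegrable (relaxKernel a 1 m) volume 0 t :=
    (continuous_relaxKernel_one ha ha1 m).intervalIntegrable _ _
  have hR : ∫ τ in (0 : ℝ)..t, (f τ - m * modeSol a m c f τ) =
      (∫ τ in (0 : ℝ)..t, f τ) - m * c * (∫ τ in (0 : ℝ)..t, relaxKernel a 1 m τ) -
        m * ∫ τ in (0 : ℝ)..t, conv (relaxKernel a a m) f τ := by
    rw [← intervalIntegral.integral_const_mul, ← intervalIntegral.integral_const_mul,
      ← intervalIntegral.integral_sub (intervalIntegrable_of_integrableOn_Ioo hf ht)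
        (he.const_mul _), ← intervalIntegral.integral_sub
        ((intervalIntegrable_of_integrableOn_Ioo hf ht).sub (he.const_mul _)) (h3.const_mul _)]
    refine intervalIntegral.integral_congr fun x _ => ?_
    simp only [modeSol]
    ring
  rw [hL, hR, h2, h4, h5, h6]
  ring

/-- Uniqueness for the scalar equation: convolving `g * z = -m (1 * z)` with the resolvent kernel
`k` gives `e * z = (e - 1) * z`, so all integrals `∫₀ᵗ z` vanish. -/
theorem eqOn_zero_of_caputo {a m T : ℝ} {z : ℝ → ℝ} (ha : 0 < a) (ha1 : a < 1) (hm : 0 ≤ m)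
    (hT : 0 < T) (hz : ContinuousOn z (Icc 0 T))
    (h : ∀ t ∈ Icc 0 T, conv (rlKernel (1 - a)) z t = -(m * ∫ τ in (0 : ℝ)..t, z τ)) :
    EqOn z 0 (Icc 0 T) := by
  have hzi : IntegrableOn z (Ioo 0 T) := (hz.integrableOn_Icc).mono_set Ioo_subset_Icc_self
  have hint : ∀ t ∈ Icc 0 T, ∫ τ in (0 : ℝ)..t, z τ = 0 := by
    intro t ht
    have h1 := (conv_assoc (M := 1) (integrableOn_relaxKernel ha ha1 ha m T)
      (integrableOn_rlKernel (b := 1 - a) (by linarith) T) hzi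
      (fun x hx => by rw [conv_comm]; exact conv_abs_rlKernel_le ha ha1 hm hx.1) ht).2
    have h2 : conv (conv (relaxKernel a a m) (rlKernel (1 - a))) z t =
        conv (relaxKernel a 1 m) z t :=
      conv_congr ht.1 (fun x hx => by
        rw [conv_comm, conv_rlKernel_relaxKernel_self ha ha1 m hx.1]) fun _ _ => rfl
    have h3 : conv (relaxKernel a a m) (conv (rlKernel (1 - a)) z) t =
        -(m * conv (relaxKernel a a m) (fun τ => ∫ σ in (0 : ℝ)..τ, z σ) t) := by
      rw [conv_congr (f' := relaxKernel a a m) (g' := fun τ => -(m * ∫ σ in (0 : ℝ)..τ, z σ)) ht.1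
        (fun _ _ => rfl) (fun x hx => h x ⟨hx.1.le, hx.2.le.trans ht.2⟩), conv, conv,
        ← intervalIntegral.integral_const_mul, ← intervalIntegral.integral_neg]
      exact intervalIntegral.integral_congr fun x _ => by ring
    rw [(conv_conv_one ha ha1 hm hzi ht).2, mul_conv_one_conv ha ha1 hzi ht, h1, h2] at h3
    linarith
  have hIoo : EqOn z 0 (Ioo 0 T) := by
    intro t ht
    have hd : HasDerivAt (fun t => ∫ τ in (0 : ℝ)..t, z τ) (z t) t :=
      intervalIntegral.integral_hasDerivAt_right
        (intervalIntegrable_of_integrableOn_Ioo hzi (Ioo_subset_Icc_self ht))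
        (hz.mono Ioo_subset_Icc_self |>.stronglyMeasurableAtFilter isOpen_Ioo t ht)
        (hz.continuousAt (Icc_mem_nhds ht.1 ht.2))
    have h0 : HasDerivAt (fun t => ∫ τ in (0 : ℝ)..t, z τ) 0 t :=
      (hasDerivAt_const t (0 : ℝ)).congr_of_eventuallyEq
        (Filter.eventuallyEq_of_mem (Icc_mem_nhds ht.1 ht.2) hint)
    exact hd.unique h0
  have := hIoo.of_subset_closure hz continuousOn_const Ioo_subset_Icc_self
    (by rw [closure_Ioo hT.ne])
  exact this

/-- The derivative of the mode for `f = f₀ + ∫ f'`. -/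
def modeDeriv (a m c f₀ : ℝ) (f' : ℝ → ℝ) (t : ℝ) : ℝ :=
  relaxKernel a a m t * (f₀ - m * c) + conv (relaxKernel a a m) f' t

theorem conv_relaxKernel_primitive {a m T t f₀ : ℝ} {f f' : ℝ → ℝ} (ha : 0 < a)
    (ha1 : a < 1) (hm : 0 ≤ m) (hf' : IntegrableOn f' (Ioo 0 T))
    (hf : ∀ t ∈ Icc 0 T, f t = f₀ + ∫ τ in (0 : ℝ)..t, f' τ) (ht : t ∈ Icc 0 T) :
    conv (relaxKernel a a m) f t = f₀ * conv (fun _ => 1) (relaxKernel a a m) t +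
      conv (conv (fun _ => 1) (relaxKernel a a m)) f' t := by
  obtain ⟨h1, h2⟩ := conv_conv_one ha ha1 hm hf' ht
  have hk : IntervalIntegrable (fun τ => relaxKernel a a m (t - τ)) volume 0 t := by
    have := (intervalIntegrable_of_integrableOn_Ioo
      (integrableOn_relaxKernel ha ha1 ha m T) ht).comp_sub_left t
    simpa using this.symm
  rw [← h2, conv_comm (fun _ => 1), conv, conv, conv, ← intervalIntegral.integral_const_mul,
    ← intervalIntegral.integral_add]
  · refine intervalIntegral.integral_congr fun x hx => ?_
    rw [uIcc_of_le ht.1] at hx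
    rw [hf x ⟨hx.1, hx.2.trans ht.2⟩]
    ring
  · simpa using hk.const_mul f₀
  · exact h1

/-- `modeDeriv` is the derivative of the mode: `u = c + 1 * y`. -/
theorem integral_modeDeriv {a m T t f₀ : ℝ} {f f' : ℝ → ℝ} (c : ℝ) (ha : 0 < a)
    (ha1 : a < 1) (hm : 0 ≤ m) (hf' : IntegrableOn f' (Ioo 0 T))
    (hf : ∀ t ∈ Icc 0 T, f t = f₀ + ∫ τ in (0 : ℝ)..t, f' τ) (ht : t ∈ Icc 0 T) :
    c + ∫ τ in (0 : ℝ)..t, modeDeriv a m c f₀ f' τ = modeSol a m c f t := by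
  obtain ⟨h1, h2⟩ := conv_one_conv ha ha1 hm hf' ht
  have hk := intervalIntegrable_of_integrableOn_Ioo (integrableOn_relaxKernel ha ha1 ha m T) ht
  simp only [modeDeriv]
  rw [intervalIntegral.integral_add (hk.mul_const _) h1, h2, modeSol,
    conv_relaxKernel_primitive ha ha1 hm hf' hf ht, intervalIntegral.integral_mul_const]
  have h3 := conv_one_relaxKernel_self ha ha1 m ht.1
  rw [conv_const_one] at h3 ⊢
  linear_combination (-c) * h3

/-- The Riemann-Liouville kernel of order `1-a` applied to the derivative of the mode. -/
theorem conv_rlKernel_modeDeriv {a m T t f₀ : ℝ} {f f' : ℝ → ℝ} (c : ℝ) (ha : 0 < a)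
    (ha1 : a < 1) (hm : 0 ≤ m) (hf' : IntegrableOn f' (Ioo 0 T))
    (hf : ∀ t ∈ Icc 0 T, f t = f₀ + ∫ τ in (0 : ℝ)..t, f' τ) (ht : t ∈ Ioc 0 T) :
    conv (rlKernel (1 - a)) (modeDeriv a m c f₀ f') t + m * modeSol a m c f t = f t := by
  have ht' := Ioc_subset_Icc_self ht
  obtain ⟨h1, h2⟩ := conv_rlKernel_conv ha ha1 hm hf' ht'
  have hk := intervalIntegrable_rlKernel_relaxKernel (b := a) (c := 1 - a) ha ha1 ha
    (by linarith) m ht'.1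
  have e : conv (rlKernel (1 - a)) (modeDeriv a m c f₀ f') t =
      conv (rlKernel (1 - a)) (relaxKernel a a m) t * (f₀ - m * c) +
        conv (rlKernel (1 - a)) (conv (relaxKernel a a m) f') t := by
    rw [conv, conv, conv, ← intervalIntegral.integral_mul_const,
      ← intervalIntegral.integral_add (hk.mul_const _) h1]
    exact intervalIntegral.integral_congr fun x _ => by simp only [modeDeriv]; ring
  have h3 := conv_one_relaxKernel_self ha ha1 m ht'.1
  have h4 := mul_conv_one_conv (m := m) ha ha1 hf' ht'
  rw [e, h2, conv_rlKernel_relaxKernel_self ha ha1 m ht.1, modeSol,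
    conv_relaxKernel_primitive ha ha1 hm hf' hf ht', hf t ht']
  linear_combination f₀ * h3 + h4

/-! ### Diagonal operators in a Hilbert basis -/

theorem intervalIntegrable_mul_norm_of_bounded {E : Type*} [NormedAddCommGroup E] {g : ℝ → ℝ} 
    {f : ℝ → E} {T t M : ℝ}
    (hg : IntegrableOn g (Ioo 0 T)) (hf : AEStronglyMeasurable f (volume.restrict (Ioo 0 T)))
    (hM : ∀ᵐ τ ∂(volume.restrict (Ioo 0 T)), ‖f τ‖ ≤ M) (ht : t ∈ Icc 0 T) :
    IntervalIntegrable (fun τ => g (t - τ) * ‖f τ‖) volume 0 t := by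
  have h1 : IntervalIntegrable (fun τ => g (t - τ)) volume 0 t := by
    simpa using ((intervalIntegrable_of_integrableOn_Ioo hg ht).comp_sub_left t).symm
  have hsub : Ioo 0 t ⊆ Ioo 0 T := Ioo_subset_Ioo_right ht.2
  rw [intervalIntegrable_iff_integrableOn_Ioo_of_le ht.1] at h1 ⊢
  refine Integrable.mul_bdd (c := M) h1 (hf.mono_measure (Measure.restrict_mono_set _ hsub)).norm ?_
  filter_upwards [ae_restrict_of_ae_restrict_of_subset hsub hM] with τ hτ
  simpa using hτ

section Diagonal

variable {H : Type*} [NormedAddCommGroup H] [InnerProductSpace ℝ H]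
  (Φ : HilbertBasis ℕ ℝ H)

theorem hasSum_inner_smul (x : H) : HasSum (fun j => inner ℝ x (Φ j) • Φ j) x := by
  have := Φ.hasSum_repr x
  simpa only [HilbertBasis.repr_apply_apply, real_inner_comm] using this

theorem hasSum_inner_sq (x : H) : HasSum (fun j => inner ℝ x (Φ j) ^ 2) (‖x‖ ^ 2) := by
  have := Φ.hasSum_inner_mul_inner x x
  rw [real_inner_self_eq_norm_sq] at this
  refine this.congr_fun fun j => ?_
  rw [real_inner_comm x (Φ j), sq]

theorem ext_inner_basis {x y : H} (h : ∀ j, inner ℝ x (Φ j) = inner ℝ y (Φ j)) : x = y := by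
  refine (hasSum_inner_smul Φ x).unique ?_
  simp only [h]
  exact hasSum_inner_smul Φ y

theorem exists_hasSum_of_summable_sq {c : ℕ → ℝ} (hc : Summable fun j => c j ^ 2) :
    ∃ y : H, (∀ j, inner ℝ y (Φ j) = c j) ∧ HasSum (fun j => c j • Φ j) y := by
  have hmem : Memℓp c 2 := by
    refine memℓp_gen ?_
    simpa using hc
  refine ⟨Φ.repr.symm ⟨c, hmem⟩, fun j => ?_, Φ.hasSum_repr_symm ⟨c, hmem⟩⟩
  rw [real_inner_comm, ← Φ.repr_apply_apply]
  simp

/-- The diagonal operator `x ↦ ∑ m_j (x, Φ_j) Φ_j`. -/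
def diagOp (m : ℕ → ℝ) (x : H) : H := ∑' j, (m j * inner ℝ x (Φ j)) • Φ j

theorem diagOp_eq {m : ℕ → ℝ} {x y : H} (h : ∀ j, inner ℝ y (Φ j) = m j * inner ℝ x (Φ j)) :
    diagOp Φ m x = y := by
  simp only [diagOp, ← h]
  exact (hasSum_inner_smul Φ y).tsum_eq

theorem inner_diagOp_of_summable {m : ℕ → ℝ} {x : H}
    (h : Summable fun j => (m j * inner ℝ x (Φ j)) ^ 2) (j : ℕ) :
    inner ℝ (diagOp Φ m x) (Φ j) = m j * inner ℝ x (Φ j) := by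
  obtain ⟨y, hy, -⟩ := exists_hasSum_of_summable_sq Φ h
  rw [diagOp_eq Φ hy, hy]

theorem summable_sq_of_bounded {m : ℕ → ℝ} {C : ℝ} (hm : ∀ j, |m j| ≤ C) (x : H) :
    Summable fun j => (m j * inner ℝ x (Φ j)) ^ 2 := by
  refine ((hasSum_inner_sq Φ x).summable.mul_left (C ^ 2)).of_nonneg_of_le
    (fun j => sq_nonneg _) fun j => ?_
  rw [mul_pow]
  exact mul_le_mul_of_nonneg_right (sq_le_sq' (abs_le.1 (hm j)).1 (abs_le.1 (hm j)).2)
    (sq_nonneg _)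

theorem inner_diagOp {m : ℕ → ℝ} {C : ℝ} (hm : ∀ j, |m j| ≤ C) (x : H) (j : ℕ) :
    inner ℝ (diagOp Φ m x) (Φ j) = m j * inner ℝ x (Φ j) :=
  inner_diagOp_of_summable Φ (summable_sq_of_bounded Φ hm x) j

theorem summable_diagOp {m : ℕ → ℝ} {C : ℝ} (hm : ∀ j, |m j| ≤ C) (x : H) :
    Summable fun j => (m j * inner ℝ x (Φ j)) • Φ j := by
  obtain ⟨y, -, h⟩ := exists_hasSum_of_summable_sq Φ (summable_sq_of_bounded Φ hm x)
  exact h.summable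

theorem norm_diagOp_le {m : ℕ → ℝ} {C : ℝ} (hm : ∀ j, |m j| ≤ C) (x : H) :
    ‖diagOp Φ m x‖ ≤ C * ‖x‖ := by
  have hC : 0 ≤ C := (abs_nonneg _).trans (hm 0)
  refine abs_le_of_sq_le_sq' ?_ (by positivity) |>.2
  rw [mul_pow]
  refine hasSum_le (fun j => ?_) (hasSum_inner_sq Φ (diagOp Φ m x))
    ((hasSum_inner_sq Φ x).mul_left (C ^ 2))
  rw [inner_diagOp Φ hm, mul_pow]
  exact mul_le_mul_of_nonneg_right (sq_le_sq' (abs_le.1 (hm j)).1 (abs_le.1 (hm j)).2)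
    (sq_nonneg _)

/-- Uniformly bounded diagonal operators converge strongly if their entries converge. -/
theorem tendsto_diagOp {ι : Type*} {l : Filter ι} {m : ι → ℕ → ℝ} {m₀ : ℕ → ℝ} {C : ℝ}
    (hm : ∀ᶠ i in l, ∀ j, |m i j| ≤ C) (hm₀ : ∀ j, |m₀ j| ≤ C)
    (h : ∀ j, Tendsto (fun i => m i j) l (𝓝 (m₀ j))) (x : H) :
    Tendsto (fun i => diagOp Φ (m i) x) l (𝓝 (diagOp Φ m₀ x)) := by
  have hC : 0 ≤ C := (abs_nonneg _).trans (hm₀ 0)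
  have key : Tendsto (fun i => ∑' j, (m i j - m₀ j) ^ 2 * inner ℝ x (Φ j) ^ 2) l
      (𝓝 (∑' _ : ℕ, 0)) := by
    refine tendsto_tsum_of_dominated_convergence
      ((hasSum_inner_sq Φ x).summable.mul_left ((2 * C) ^ 2)) (fun j => ?_) ?_
    · have := (((h j).sub_const (m₀ j)).pow 2).mul_const (inner ℝ x (Φ j) ^ 2)
      simpa using this
    · filter_upwards [hm] with i hi j
      rw [norm_mul, norm_pow, norm_pow, Real.norm_eq_abs, Real.norm_eq_abs, sq_abs (inner ℝ x _)]
      have : |m i j - m₀ j| ≤ 2 * C := (abs_sub _ _).trans (by linarith [hi j, hm₀ j])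
      gcongr
  rw [tsum_zero] at key
  rw [tendsto_iff_norm_sub_tendsto_zero]
  have hsq : Tendsto (fun i => ‖diagOp Φ (m i) x - diagOp Φ m₀ x‖ ^ 2) l (𝓝 0) := by
    refine key.congr' ?_
    filter_upwards [hm] with i hi
    rw [← (hasSum_inner_sq Φ (diagOp Φ (m i) x - diagOp Φ m₀ x)).tsum_eq]
    refine tsum_congr fun j => ?_
    rw [inner_sub_left, inner_diagOp Φ hi, inner_diagOp Φ hm₀]
    ring
  have := hsq.sqrt
  simpa [Real.sqrt_sq (norm_nonneg _)] using this

/-- Strong measurability can be checked on coordinates: the function is the limit of its partial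
sums. -/
theorem aestronglyMeasurable_of_inner {X : Type*} [MeasurableSpace X] {ν : Measure X} {f : X → H}
    (h : ∀ j, AEStronglyMeasurable (fun t => inner ℝ (f t) (Φ j)) ν) :
    AEStronglyMeasurable f ν := by
  refine aestronglyMeasurable_of_tendsto_ae atTop
    (f := fun n t => ∑ j ∈ Finset.range n, inner ℝ (f t) (Φ j) • Φ j) (fun n => ?_)
    (Eventually.of_forall fun t => (hasSum_inner_smul Φ (f t)).tendsto_sum_nat)
  exact Finset.aestronglyMeasurable_fun_sum _ fun j _ => (h j).smul_const _

/-! ### Convolution with a diagonal operator kernel -/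

/-- The convolution `∫₀ᵗ K(t-τ) f(τ) dτ` with the diagonal operators `K(r)` with entries
`κ_j(r)`. -/
def opConv (κ : ℕ → ℝ → ℝ) (f : ℝ → H) (t : ℝ) : H :=
  ∫ τ in (0 : ℝ)..t, diagOp Φ (fun j => κ j (t - τ)) (f τ)

theorem sub_mem_Ioo {t τ : ℝ} (h : τ ∈ Ioo 0 t) : t - τ ∈ Ioo 0 t :=
  ⟨by linarith [h.2], by linarith [h.1]⟩

theorem intervalIntegrable_opConv {κ : ℕ → ℝ → ℝ} {g : ℝ → ℝ} {f : ℝ → H} {t : ℝ} (ht : 0 ≤ t)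
    (hκ : ∀ j, Measurable (κ j)) (hg : ∀ r ∈ Ioo 0 t, ∀ j, |κ j r| ≤ g r)
    (hf : AEStronglyMeasurable f (volume.restrict (Ioo 0 t)))
    (hi : IntervalIntegrable (fun τ => g (t - τ) * ‖f τ‖) volume 0 t) :
    IntervalIntegrable (fun τ => diagOp Φ (fun j => κ j (t - τ)) (f τ)) volume 0 t := by
  rw [intervalIntegrable_iff_integrableOn_Ioo_of_le ht] at hi ⊢
  refine Integrable.mono' hi (aestronglyMeasurable_of_inner Φ fun j => ?_) ?_
  · have h1 : AEStronglyMeasurable (fun τ => κ j (t - τ) * inner ℝ (f τ) (Φ j))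
        (volume.restrict (Ioo 0 t)) :=
      ((hκ j).comp (measurable_const.sub measurable_id)).aestronglyMeasurable.mul
        (hf.inner aestronglyMeasurable_const)
    refine h1.congr ?_
    filter_upwards [ae_restrict_mem measurableSet_Ioo] with τ hτ
    rw [inner_diagOp Φ (hg _ (sub_mem_Ioo hτ))]
  · filter_upwards [ae_restrict_mem measurableSet_Ioo] with τ hτ
    exact norm_diagOp_le Φ (hg _ (sub_mem_Ioo hτ)) _

theorem inner_opConv [CompleteSpace H] {κ : ℕ → ℝ → ℝ} {g : ℝ → ℝ} {f : ℝ → H} {t : ℝ} (ht : 0 ≤ t)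
    (hκ : ∀ j, Measurable (κ j)) (hg : ∀ r ∈ Ioo 0 t, ∀ j, |κ j r| ≤ g r)
    (hf : AEStronglyMeasurable f (volume.restrict (Ioo 0 t)))
    (hi : IntervalIntegrable (fun τ => g (t - τ) * ‖f τ‖) volume 0 t) (j : ℕ) :
    IntervalIntegrable (fun τ => κ j (t - τ) * inner ℝ (f τ) (Φ j)) volume 0 t ∧
    inner ℝ (opConv Φ κ f t) (Φ j) = conv (κ j) (fun τ => inner ℝ (f τ) (Φ j)) t := by
  have h := intervalIntegrable_opConv Φ ht hκ hg hf hi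
  have hL : ∀ x : H, inner ℝ x (Φ j) = innerSL ℝ (Φ j) x := fun x => by
    rw [innerSL_apply_apply, real_inner_comm]
  have hcongr : ∀ τ ∈ Ioo 0 t, innerSL ℝ (Φ j) (diagOp Φ (fun j => κ j (t - τ)) (f τ)) =
      κ j (t - τ) * inner ℝ (f τ) (Φ j) := fun τ hτ => by
    rw [← hL, inner_diagOp Φ (hg _ (sub_mem_Ioo hτ))]
  constructor
  · rw [intervalIntegrable_iff_integrableOn_Ioo_of_le ht] at h ⊢
    exact (integrableOn_congr_fun hcongr measurableSet_Ioo).1 ((innerSL ℝ (Φ j)).integrable_comp h)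
  · rw [hL, opConv, ← ContinuousLinearMap.intervalIntegral_comp_comm _ h, conv,
      intervalIntegral.integral_of_le ht, intervalIntegral.integral_of_le ht,
      integral_Ioc_eq_integral_Ioo, integral_Ioc_eq_integral_Ioo]
    exact setIntegral_congr_fun measurableSet_Ioo hcongr

theorem norm_opConv_le {κ : ℕ → ℝ → ℝ} {g : ℝ → ℝ} {f : ℝ → H} {t : ℝ} (ht : 0 ≤ t)
    (hg : ∀ r ∈ Ioo 0 t, ∀ j, |κ j r| ≤ g r)
    (hi : IntervalIntegrable (fun τ => g (t - τ) * ‖f τ‖) volume 0 t) :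
    ‖opConv Φ κ f t‖ ≤ conv g (fun τ => ‖f τ‖) t := by
  rw [intervalIntegrable_iff_integrableOn_Ioo_of_le ht] at hi
  rw [opConv, conv, intervalIntegral.integral_of_le ht, intervalIntegral.integral_of_le ht,
    integral_Ioc_eq_integral_Ioo, integral_Ioc_eq_integral_Ioo]
  refine norm_integral_le_of_norm_le hi ?_
  filter_upwards [ae_restrict_mem measurableSet_Ioo] with τ hτ
  exact norm_diagOp_le Φ (hg _ (sub_mem_Ioo hτ)) _

/-- Convolution with an integrable operator kernel maps `L¹(0,T;H)` to itself. -/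
theorem integrableOn_opConv [CompleteSpace H] {κ : ℕ → ℝ → ℝ} {g : ℝ → ℝ} {f : ℝ → H} {T : ℝ}
    (hκ : ∀ j, Measurable (κ j)) (hκi : ∀ j, IntegrableOn (κ j) (Ioo 0 T))
    (hg : ∀ r ∈ Ioo 0 T, ∀ j, |κ j r| ≤ g r) (hgi : IntegrableOn g (Ioo 0 T))
    (hf : IntegrableOn f (Ioo 0 T)) : IntegrableOn (opConv Φ κ f) (Ioo 0 T) := by
  have hae := ae_intervalIntegrable_conv hgi hf.norm
  refine Integrable.mono' (integrableOn_conv hgi hf.norm)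
    (aestronglyMeasurable_of_inner Φ fun j => ?_) ?_
  · refine (integrableOn_conv (hκi j) (hf.inner_const (𝕜 := ℝ) (Φ j))).1.congr ?_
    filter_upwards [hae, ae_restrict_mem measurableSet_Ioo] with t h1 ht
    exact (inner_opConv Φ ht.1.le hκ (fun r hr => hg r ⟨hr.1, hr.2.trans ht.2⟩)
      (hf.1.mono_measure (Measure.restrict_mono_set _ (Ioo_subset_Ioo_right ht.2.le))) h1 j).2.symm
  · filter_upwards [hae, ae_restrict_mem measurableSet_Ioo] with t h1 ht
    exact norm_opConv_le Φ ht.1.le (fun r hr => hg r ⟨hr.1, hr.2.trans ht.2⟩) h1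

/-- Away from its singularity at `0` the kernel is strongly continuous and bounded, so the truncated
convolution is continuous by dominated convergence. -/
theorem continuous_opConv_truncated {κ : ℕ → ℝ → ℝ} {g : ℝ → ℝ} {f : ℝ → H} {T M ε : ℝ}
    (hε : 0 < ε) (hκ : ∀ j, Measurable (κ j)) (hκc : ∀ j, ContinuousOn (κ j) (Ioi 0))
    (hg : ∀ r, 0 < r → ∀ j, |κ j r| ≤ g r) (hanti : AntitoneOn g (Ioi 0))
    (hf : AEStronglyMeasurable f (volume.restrict (Ioo 0 T)))
    (hM : ∀ᵐ τ ∂(volume.restrict (Ioo 0 T)), ‖f τ‖ ≤ M) :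
    Continuous fun t =>
      ∫ τ in Ioo 0 T, diagOp Φ (fun j => (Ioi ε).indicator (κ j) (t - τ)) (f τ) := by
  have hbd : ∀ r j, |(Ioi ε).indicator (κ j) r| ≤ g ε := fun r j => by
    have hgε : 0 ≤ g ε := (abs_nonneg _).trans (hg ε hε 0)
    by_cases hr : r ∈ Ioi ε
    · rw [indicator_of_mem hr]
      exact (hg r (hε.trans hr) j).trans (hanti hε (hε.trans hr) (le_of_lt hr))
    · rw [indicator_of_notMem hr]; simpa using hgε
  refine continuous_iff_continuousAt.2 fun t₀ => ?_
  refine continuousAt_of_dominated (bound := fun _ => g ε * M) (Eventually.of_forall fun t => ?_)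
    (Eventually.of_forall fun t => ?_) (integrableOn_const (by simp)) ?_
  · refine aestronglyMeasurable_of_inner Φ fun j => ?_
    simp only [inner_diagOp Φ (hbd _)]
    exact ((((hκ j).indicator measurableSet_Ioi).comp
      (measurable_const.sub measurable_id)).aestronglyMeasurable).mul
        (hf.inner aestronglyMeasurable_const)
  · filter_upwards [hM] with τ hτ
    refine (norm_diagOp_le Φ (hbd _) _).trans ?_
    exact mul_le_mul_of_nonneg_left hτ ((abs_nonneg _).trans (hg ε hε 0))
  · -- the truncated kernel jumps at `ε` only, that is, at `τ = t₀ - ε`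
    have hne : ∀ᵐ τ ∂(volume.restrict (Ioo 0 T)), τ ≠ t₀ - ε :=
      ae_restrict_of_ae (Measure.ae_ne volume _)
    filter_upwards [hne] with τ hτ
    refine tendsto_diagOp Φ (C := g ε) (Eventually.of_forall fun t j => hbd _ j)
      (fun j => hbd _ j) (fun j => ?_) _
    have hsub : Tendsto (fun t => t - τ) (𝓝 t₀) (𝓝 (t₀ - τ)) :=
      (continuous_id.sub continuous_const).tendsto t₀
    suffices ContinuousAt ((Ioi ε).indicator (κ j)) (t₀ - τ) from this.tendsto.comp hsub
    rcases lt_or_gt_of_ne hτ with h | h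
    · have hm : t₀ - τ ∈ Ioi ε := by
        simp only [mem_Ioi]; linarith
      refine ((hκc j).continuousAt (Ioi_mem_nhds (hε.trans hm))).congr ?_
      filter_upwards [Ioi_mem_nhds hm] with r hr
      rw [indicator_of_mem hr]
    · have hm : t₀ - τ < ε := by linarith
      refine (continuousAt_const (y := (0 : ℝ))).congr ?_
      filter_upwards [Iio_mem_nhds hm] with r hr
      rw [indicator_of_notMem (notMem_Ioi.2 (le_of_lt hr))]

/-- Convolution of an integrable, strongly continuous operator kernel with a bounded function is
continuous: it is the uniform limit of the truncated convolutions. -/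
theorem continuousOn_opConv [CompleteSpace H] {κ : ℕ → ℝ → ℝ} {g : ℝ → ℝ} {f : ℝ → H} {T M : ℝ}
    (hκ : ∀ j, Measurable (κ j)) (hκc : ∀ j, ContinuousOn (κ j) (Ioi 0))
    (hg : ∀ r, 0 < r → ∀ j, |κ j r| ≤ g r) (hanti : AntitoneOn g (Ioi 0))
    (hgi : IntegrableOn g (Ioo 0 T))
    (hf : AEStronglyMeasurable f (volume.restrict (Ioo 0 T)))
    (hM : ∀ᵐ τ ∂(volume.restrict (Ioo 0 T)), ‖f τ‖ ≤ M) :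
    ContinuousOn (opConv Φ κ f) (Icc 0 T) := by
  rcases le_or_gt T 0 with hT | hT
  · exact (subsingleton_Icc_of_ge hT).continuousOn _
  refine continuousOn_of_uniform_approx_of_continuousOn fun u hu => ?_
  obtain ⟨η, hη, hηu⟩ := Metric.mem_uniformity_dist.1 hu
  obtain ⟨ε, hε, hεη⟩ : ∃ ε ∈ Ioo 0 T, (∫ r in (0 : ℝ)..ε, g r) * |M| < η := by
    have hcont : ContinuousOn (fun ε => (∫ r in (0 : ℝ)..ε, g r) * |M|) (Icc 0 T) := by
      have := intervalIntegral.continuousOn_primitive_interval (f := g) (a := 0) (b := T)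
        (μ := volume) ?_
      · rw [uIcc_of_le hT.le] at this
        exact this.mul continuousOn_const
      · rw [uIcc_of_le hT.le, integrableOn_Icc_iff_integrableOn_Ioo]
        exact hgi
    have hlim := (hcont 0 ⟨le_rfl, hT.le⟩).mono_left (nhdsWithin_mono 0 Ioo_subset_Icc_self)
    simp only [intervalIntegral.integral_same, zero_mul, nhdsWithin_Ioo_eq_nhdsGT hT] at hlim
    obtain ⟨ε, h1, h2⟩ := ((hlim.eventually (gt_mem_nhds hη)).and (Ioo_mem_nhdsGT hT)).exists
    exact ⟨ε, h2, h1⟩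
  refine ⟨_, (continuous_opConv_truncated Φ hε.1 hκ hκc hg hanti hf hM).continuousOn,
    fun t ht => hηu ?_⟩
  have hsub : Ioo 0 t ⊆ Ioo 0 T := Ioo_subset_Ioo_right ht.2
  have hft : AEStronglyMeasurable f (volume.restrict (Ioo 0 t)) :=
    hf.mono_measure (Measure.restrict_mono_set _ hsub)
  have hg0 : ∀ r ∈ Ioo 0 t, 0 ≤ g r := fun r hr => (abs_nonneg _).trans (hg r hr.1 0)
  have hbig : ∀ r ∈ Ioo 0 t, ∀ j, |(Ioi ε).indicator (κ j) r| ≤ g r := fun r hr j => by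
    by_cases h : r ∈ Ioi ε
    · rw [indicator_of_mem h]; exact hg r hr.1 j
    · rw [indicator_of_notMem h, abs_zero]; exact hg0 r hr
  have hsmall : ∀ r ∈ Ioo 0 t, ∀ j, |(Iic ε).indicator (κ j) r| ≤ (Iic ε).indicator g r :=
    fun r hr j => by
      by_cases h : r ∈ Iic ε
      · rw [indicator_of_mem h, indicator_of_mem h]; exact hg r hr.1 j
      · rw [indicator_of_notMem h, indicator_of_notMem h, abs_zero]
  have hi := intervalIntegrable_mul_norm_of_bounded hgi hf hM ht
  have hgs : IntegrableOn ((Iic ε).indicator g) (Ioo 0 T) :=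
    Integrable.indicator hgi measurableSet_Iic
  have his := intervalIntegrable_mul_norm_of_bounded hgs hf hM ht
  -- the truncated kernel vanishes for `τ ≥ t`, so the truncated convolution is causal
  have htrunc : (∫ τ in Ioo 0 T, diagOp Φ (fun j => (Ioi ε).indicator (κ j) (t - τ)) (f τ)) =
      opConv Φ (fun j => (Ioi ε).indicator (κ j)) f t := by
    rw [opConv, intervalIntegral.integral_of_le ht.1, integral_Ioc_eq_integral_Ioo]
    refine (setIntegral_eq_of_subset_of_forall_sdiff_eq_zero measurableSet_Ioo hsub
      fun τ hτ => ?_)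
    have : t - τ ∉ Ioi ε := fun h => hτ.2 ⟨hτ.1.1, by
      have := hε.1
      simp only [mem_Ioi] at h
      linarith⟩
    simp [indicator_of_notMem this, diagOp]
  -- the error of the truncation is the convolution with the part of the kernel on `(0,ε]`
  have hdiff : opConv Φ κ f t - opConv Φ (fun j => (Ioi ε).indicator (κ j)) f t =
      opConv Φ (fun j => (Iic ε).indicator (κ j)) f t := by
    rw [opConv, opConv, opConv, ← intervalIntegral.integral_sub
      (intervalIntegrable_opConv Φ ht.1 hκ (fun r hr => hg r hr.1) hft hi)
      (intervalIntegrable_opConv Φ ht.1 (fun j => (hκ j).indicator measurableSet_Ioi) hbig hft hi),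
      intervalIntegral.integral_of_le ht.1, intervalIntegral.integral_of_le ht.1,
      integral_Ioc_eq_integral_Ioo, integral_Ioc_eq_integral_Ioo]
    refine setIntegral_congr_fun measurableSet_Ioo fun τ hτ => ?_
    refine (diagOp_eq Φ fun j => ?_).symm
    have hτ' := sub_mem_Ioo hτ
    rw [inner_sub_left, inner_diagOp Φ (hg _ hτ'.1), inner_diagOp Φ (hbig _ hτ'), ← sub_mul]
    congr 1
    by_cases h : t - τ ≤ ε
    · rw [indicator_of_notMem (notMem_Ioi.2 h), indicator_of_mem (mem_Iic.2 h), sub_zero]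
    · rw [indicator_of_mem (mem_Ioi.2 (not_le.1 h)),
        indicator_of_notMem (notMem_Iic.2 (not_le.1 h)), sub_self]
  rw [dist_eq_norm, htrunc, hdiff]
  refine lt_of_le_of_lt ((norm_opConv_le Φ ht.1 hsmall his).trans ?_) hεη
  have hgt : IntervalIntegrable ((Iic ε).indicator g) volume 0 t :=
    intervalIntegrable_of_integrableOn_Ioo hgs ht
  have hnn : ∀ r, 0 < r → 0 ≤ (Iic ε).indicator g r := fun r hr => by
    refine indicator_apply_nonneg fun _ => (abs_nonneg _).trans (hg r hr 0)
  calc conv ((Iic ε).indicator g) (fun τ => ‖f τ‖) t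
      ≤ conv ((Iic ε).indicator g) (fun _ => |M|) t := by
        refine intervalIntegral.integral_mono_ae_restrict ht.1 his
          (by simpa using (hgt.comp_sub_left t).symm.mul_const |M|) ?_
        rw [Measure.restrict_congr_set Ioo_ae_eq_Icc.symm]
        filter_upwards [ae_restrict_of_ae_restrict_of_subset hsub hM,
          ae_restrict_mem measurableSet_Ioo] with τ hτ hτ'
        exact mul_le_mul_of_nonneg_left (hτ.trans (le_abs_self M)) (hnn _ (sub_mem_Ioo hτ').1)
    _ = (∫ r in (0 : ℝ)..t, (Iic ε).indicator g r) * |M| := by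
        rw [conv_comm, conv, ← intervalIntegral.integral_mul_const]
        exact intervalIntegral.integral_congr fun r _ => mul_comm _ _
    _ ≤ (∫ r in (0 : ℝ)..ε, g r) * |M| := by
        refine mul_le_mul_of_nonneg_right ?_ (abs_nonneg _)
        calc _ ≤ ∫ r in (0 : ℝ)..T, (Iic ε).indicator g r := by
              refine intervalIntegral.integral_mono_interval le_rfl ht.1 ht.2 ?_
                (intervalIntegrable_of_integrableOn_Ioo hgs ⟨hT.le, le_rfl⟩)
              filter_upwards [ae_restrict_mem measurableSet_Ioc] with r hr
              exact hnn r hr.1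
          _ = _ := intervalIntegral.integral_indicator ⟨hε.1.le, hε.2.le⟩

end Diagonal

theorem measurable_relaxKernel {a b : ℝ} (ha : 0 < a) (ha1 : a < 1) (hb : 0 < b) (m : ℝ) :
    Measurable (relaxKernel a b m) :=
  (measurable_id.pow_const _).mul (((continuous_mittagLeffler ha ha1 hb).comp
    (continuous_const.mul (Real.continuous_rpow_const ha.le))).measurable)

theorem antitoneOn_rlKernel {a : ℝ} (ha : 0 < a) (ha1 : a < 1) :
    AntitoneOn (rlKernel a) (Ioi 0) := fun x hx y _ hxy =>
  div_le_div_of_nonneg_right (Real.rpow_le_rpow_of_nonpos hx hxy (by linarith))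
    (Real.Gamma_pos_of_pos ha).le

theorem abs_relaxKernel_le {a m r : ℝ} (ha : 0 < a) (ha1 : a < 1) (hm : 0 ≤ m) (hr : 0 < r) :
    |relaxKernel a a m r| ≤ rlKernel a r := by
  rw [abs_of_nonneg (relaxKernel_self_nonneg ha ha1 hm hr.le)]
  exact relaxKernel_self_le ha ha1 hm hr

theorem abs_relaxKernel_one_le {a m t : ℝ} (ha : 0 < a) (ha1 : a < 1) (hm : 0 ≤ m) (ht : 0 ≤ t) :
    |relaxKernel a 1 m t| ≤ 1 := by
  have := relaxKernel_one_mem ha ha1 hm ht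
  rw [abs_of_nonneg this.1]
  exact this.2

theorem intervalIntegrable_rpow_smul {E : Type*} [NormedAddCommGroup E]
    [NormedSpace ℝ E] {a T : ℝ} {w : ℝ → E} (ha1 : a < 1) (hw : ContinuousOn w (Icc 0 T))
    {t : ℝ} (ht : t ∈ Icc 0 T) :
    IntervalIntegrable (fun τ => (t - τ) ^ (1 - a - 1) • w τ) volume 0 t := by
  have h : IntervalIntegrable (fun τ : ℝ => τ ^ (1 - a - 1)) volume 0 t :=
    intervalIntegral.intervalIntegrable_rpow' (by linarith)
  have h' : IntervalIntegrable (fun τ : ℝ => (t - τ) ^ (1 - a - 1)) volume 0 t := by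
    simpa using (h.comp_sub_left t).symm
  refine h'.smul_continuousOn ?_
  rw [uIcc_of_le ht.1]
  exact hw.mono (Icc_subset_Icc_right ht.2)

theorem integral_congr_Ioo {E : Type*} [NormedAddCommGroup E] [NormedSpace ℝ E] {T : ℝ}
    {p q : ℝ → E}
    (h : ∀ᵐ τ ∂(volume.restrict (Ioo 0 T)), p τ = q τ) {t : ℝ} (ht : t ∈ Icc 0 T) :
    ∫ τ in (0 : ℝ)..t, p τ = ∫ τ in (0 : ℝ)..t, q τ := by
  rw [intervalIntegral.integral_of_le ht.1, intervalIntegral.integral_of_le ht.1,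
    integral_Ioc_eq_integral_Ioo, integral_Ioc_eq_integral_Ioo]
  exact integral_congr_ae (ae_restrict_of_ae_restrict_of_subset (Ioo_subset_Ioo_right ht.2) h)

/-! ### The abstract equation `∂ₜ^a u + A u = f` with `A` diagonal -/

section Abstract

variable {H : Type*} [NormedAddCommGroup H] [InnerProductSpace ℝ H] [CompleteSpace H]
  (Φ : HilbertBasis ℕ ℝ H)

theorem inner_intervalIntegral {f : ℝ → H} {a b : ℝ} (hf : IntervalIntegrable f volume a b)
    (x : H) : inner ℝ (∫ τ in a..b, f τ) x = ∫ τ in a..b, inner ℝ (f τ) x := by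
  have := ContinuousLinearMap.intervalIntegral_comp_comm (innerSL ℝ x) hf
  simp only [innerSL_apply_apply] at this
  rw [real_inner_comm, ← this]
  simp only [real_inner_comm]

theorem inner_fracIntegral {f : ℝ → H} {b t : ℝ}
    (hf : IntervalIntegrable (fun τ => (t - τ) ^ (b - 1) • f τ) volume 0 t) (x : H) :
    inner ℝ (fracIntegral b f t) x = conv (rlKernel b) (fun τ => inner ℝ (f τ) x) t := by
  rw [fracIntegral, real_inner_smul_left, inner_intervalIntegral hf, conv,
    ← intervalIntegral.integral_const_mul]
  refine intervalIntegral.integral_congr fun τ _ => ?_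
  simp only [real_inner_smul_left, rlKernel]
  ring

theorem inner_primitive {f f' : ℝ → H} {T : ℝ} (hf' : IntegrableOn f' (Ioo 0 T))
    (hf : ∀ t ∈ Icc 0 T, f t = f 0 + ∫ τ in (0 : ℝ)..t, f' τ) (x : H) :
    ∀ t ∈ Icc 0 T, inner ℝ (f t) x = inner ℝ (f 0) x + ∫ τ in (0 : ℝ)..t, inner ℝ (f' τ) x := by
  intro t ht
  rw [hf t ht, inner_add_left,
    inner_intervalIntegral (intervalIntegrable_of_integrableOn_Ioo hf' ht)]

/-- The solution `∑ E_{a,1}(-μ_j t^a) (u₀, Φ_j) Φ_j + ∫₀ᵗ K(t-τ) f(τ) dτ` of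
`∂ₜ^a u + A u = f`, where `A` is diagonal with entries `μ_j`. -/
def vecSol (a : ℝ) (μ : ℕ → ℝ) (u₀ : H) (f : ℝ → H) (t : ℝ) : H :=
  diagOp Φ (fun j => relaxKernel a 1 (μ j) t) u₀ + opConv Φ (fun j => relaxKernel a a (μ j)) f t

variable {a T M : ℝ} {μ : ℕ → ℝ} {u₀ : H} {f : ℝ → H}

theorem inner_opConv_relaxKernel (ha : 0 < a) (ha1 : a < 1) (hμ : ∀ j, 0 ≤ μ j)
    (hf : AEStronglyMeasurable f (volume.restrict (Ioo 0 T)))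
    (hM : ∀ᵐ τ ∂(volume.restrict (Ioo 0 T)), ‖f τ‖ ≤ M) {t : ℝ} (ht : t ∈ Icc 0 T) (j : ℕ) :
    IntervalIntegrable (fun τ => relaxKernel a a (μ j) (t - τ) * inner ℝ (f τ) (Φ j)) volume 0 t ∧
    inner ℝ (opConv Φ (fun j => relaxKernel a a (μ j)) f t) (Φ j) =
      conv (relaxKernel a a (μ j)) (fun τ => inner ℝ (f τ) (Φ j)) t :=
  inner_opConv Φ (g := rlKernel a) ht.1 (fun _ => measurable_relaxKernel ha ha1 ha _)
    (fun _ hr j => abs_relaxKernel_le ha ha1 (hμ j) hr.1)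
    (hf.mono_measure (Measure.restrict_mono_set _ (Ioo_subset_Ioo_right ht.2)))
    (intervalIntegrable_mul_norm_of_bounded (integrableOn_rlKernel ha T) hf hM ht) j

theorem inner_vecSol (ha : 0 < a) (ha1 : a < 1) (hμ : ∀ j, 0 ≤ μ j)
    (hf : AEStronglyMeasurable f (volume.restrict (Ioo 0 T)))
    (hM : ∀ᵐ τ ∂(volume.restrict (Ioo 0 T)), ‖f τ‖ ≤ M) {t : ℝ} (ht : t ∈ Icc 0 T) (j : ℕ) :
    inner ℝ (vecSol Φ a μ u₀ f t) (Φ j) =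
      modeSol a (μ j) (inner ℝ u₀ (Φ j)) (fun τ => inner ℝ (f τ) (Φ j)) t := by
  rw [vecSol, inner_add_left, (inner_opConv_relaxKernel Φ ha ha1 hμ hf hM ht j).2,
    inner_diagOp Φ (C := 1) (fun j => abs_relaxKernel_one_le ha ha1 (hμ j) ht.1), modeSol]

theorem continuousOn_vecSol (ha : 0 < a) (ha1 : a < 1) (hμ : ∀ j, 0 ≤ μ j)
    (hf : AEStronglyMeasurable f (volume.restrict (Ioo 0 T)))
    (hM : ∀ᵐ τ ∂(volume.restrict (Ioo 0 T)), ‖f τ‖ ≤ M) :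
    ContinuousOn (vecSol Φ a μ u₀ f) (Icc 0 T) := by
  refine ContinuousOn.add (fun t ht => ?_) ?_
  · refine tendsto_diagOp Φ (C := 1) ?_
      (fun j => abs_relaxKernel_one_le ha ha1 (hμ j) ht.1)
      (fun j => (continuous_relaxKernel_one ha ha1 (μ j)).continuousWithinAt) u₀
    filter_upwards [self_mem_nhdsWithin] with t ht j
    exact abs_relaxKernel_one_le ha ha1 (hμ j) ht.1
  · exact continuousOn_opConv Φ (fun j => measurable_relaxKernel ha ha1 ha _)
      (fun j => continuousOn_relaxKernel ha ha1 ha _)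
      (fun r hr j => abs_relaxKernel_le ha ha1 (hμ j) hr) (antitoneOn_rlKernel ha ha1)
      (integrableOn_rlKernel ha T) hf hM

/-- A continuous function whose modes solve the scalar equations solves the vector equation. -/
theorem hasCaputoDeriv_of_modes {w v : ℝ → H} (ha : 0 < a) (ha1 : a < 1) (hμ : ∀ j, 0 ≤ μ j)
    (hf : IntegrableOn f (Ioo 0 T)) (hw : ContinuousOn w (Icc 0 T))
    (hmode : ∀ t ∈ Icc 0 T, ∀ j, inner ℝ (w t) (Φ j) =
      modeSol a (μ j) (inner ℝ u₀ (Φ j)) (fun τ => inner ℝ (f τ) (Φ j)) t)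
    (hv : IntegrableOn v (Ioo 0 T))
    (hvj : ∀ᵐ t ∂(volume.restrict (Ioo 0 T)), ∀ j,
      inner ℝ (v t) (Φ j) = inner ℝ (f t) (Φ j) - μ j * inner ℝ (w t) (Φ j)) (hT : 0 ≤ T) :
    HasCaputoDeriv a T w v := by
  refine ⟨intervalIntegrable_of_integrableOn_Ioo hv ⟨hT, le_rfl⟩, fun t ht => ?_⟩
  refine ext_inner_basis Φ fun j => ?_
  have h0 : inner ℝ (w 0) (Φ j) = inner ℝ u₀ (Φ j) := by
    rw [hmode 0 ⟨le_rfl, hT⟩, modeSol_zero ha]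
  rw [inner_fracIntegral (f := fun τ => w τ - w 0)
        (intervalIntegrable_rpow_smul ha1 (hw.sub continuousOn_const) ht),
    inner_intervalIntegral (intervalIntegrable_of_integrableOn_Ioo hv ht),
    integral_congr_Ioo (hvj.mono fun τ h => h j) ht]
  have h1 := modeSol_caputo (inner ℝ u₀ (Φ j)) ha ha1 (hμ j) (hf.inner_const (𝕜 := ℝ) (Φ j)) ht
  rw [conv_congr (f' := rlKernel (1 - a)) (g' := fun τ => modeSol a (μ j) (inner ℝ u₀ (Φ j))
    (fun τ => inner ℝ (f τ) (Φ j)) τ - inner ℝ u₀ (Φ j)) ht.1 (fun _ _ => rfl) (fun x hx => ?_), h1]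
  · refine intervalIntegral.integral_congr fun τ hτ => ?_
    rw [uIcc_of_le ht.1] at hτ
    rw [hmode τ ⟨hτ.1, hτ.2.trans ht.2⟩]
  · simp only [inner_sub_left]
    rw [hmode x ⟨hx.1.le, hx.2.le.trans ht.2⟩, h0]

/-- Uniqueness: each mode of the difference of two solutions solves the homogeneous scalar
equation. -/
theorem eqOn_vecSol_of_hasCaputoDeriv {w v : ℝ → H} (ha : 0 < a) (ha1 : a < 1) (hμ : ∀ j, 0 ≤ μ j)
    (hT : 0 < T) (hf : AEStronglyMeasurable f (volume.restrict (Ioo 0 T)))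
    (hM : ∀ᵐ τ ∂(volume.restrict (Ioo 0 T)), ‖f τ‖ ≤ M)
    (hw : ContinuousOn w (Icc 0 T)) (hw0 : w 0 = u₀) (hv : HasCaputoDeriv a T w v)
    (hvj : ∀ᵐ t ∂(volume.restrict (Ioo 0 T)), ∀ j,
      inner ℝ (v t) (Φ j) = inner ℝ (f t) (Φ j) - μ j * inner ℝ (w t) (Φ j)) :
    EqOn w (vecSol Φ a μ u₀ f) (Icc 0 T) := by
  have hu := continuousOn_vecSol (u₀ := u₀) Φ ha ha1 hμ hf hM
  have hfi : IntegrableOn f (Ioo 0 T) :=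
    Integrable.of_bound hf M hM
  have hvi : IntegrableOn v (Ioo 0 T) :=
    (intervalIntegrable_iff_integrableOn_Ioo_of_le hT.le).1 hv.1
  have hb : 0 < 1 - a := by linarith
  have hzero : ∀ j, EqOn (fun t => inner ℝ (w t - vecSol Φ a μ u₀ f t) (Φ j)) 0 (Icc 0 T) := by
    intro j
    have hwc : ContinuousOn (fun t => inner ℝ (w t) (Φ j)) (Icc 0 T) := hw.inner continuousOn_const
    have huc : ContinuousOn (fun t => inner ℝ (vecSol Φ a μ u₀ f t) (Φ j)) (Icc 0 T) :=
      hu.inner continuousOn_const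
    refine eqOn_zero_of_caputo ha ha1 (hμ j) hT ((hw.sub hu).inner continuousOn_const)
      fun t ht => ?_
    have hsub : uIcc 0 t ⊆ Icc 0 T := by
      rw [uIcc_of_le ht.1]; exact Icc_subset_Icc_right ht.2
    have h1 := congrArg (fun x => inner ℝ x (Φ j)) (hv.2 t ht)
    rw [inner_fracIntegral (f := fun τ => w τ - w 0)
        (intervalIntegrable_rpow_smul ha1 (hw.sub continuousOn_const) ht),
      inner_intervalIntegral (intervalIntegrable_of_integrableOn_Ioo hvi ht),
      integral_congr_Ioo (hvj.mono fun τ h => h j) ht] at h1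
    have h2 := modeSol_caputo (inner ℝ u₀ (Φ j)) ha ha1 (hμ j)
      (hfi.inner_const (𝕜 := ℝ) (Φ j)) ht
    have hk : IntervalIntegrable (fun τ => rlKernel (1 - a) (t - τ)) volume 0 t := by
      simpa using ((intervalIntegrable_of_integrableOn_Ioo
        (integrableOn_rlKernel hb T) ht).comp_sub_left t).symm
    have hmode : ∀ τ ∈ uIcc 0 t, inner ℝ (vecSol Φ a μ u₀ f τ) (Φ j) =
        modeSol a (μ j) (inner ℝ u₀ (Φ j)) (fun τ => inner ℝ (f τ) (Φ j)) τ := fun τ hτ =>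
      inner_vecSol Φ ha ha1 hμ hf hM (hsub hτ) j
    have hmc : ContinuousOn (modeSol a (μ j) (inner ℝ u₀ (Φ j)) fun τ => inner ℝ (f τ) (Φ j))
        (uIcc 0 t) := (huc.mono hsub).congr fun τ hτ => (hmode τ hτ).symm
    have h3 : conv (rlKernel (1 - a)) (fun τ => inner ℝ (w τ - vecSol Φ a μ u₀ f τ) (Φ j)) t =
        conv (rlKernel (1 - a)) (fun τ => inner ℝ (w τ - w 0) (Φ j)) t -
        conv (rlKernel (1 - a)) (fun τ => modeSol a (μ j) (inner ℝ u₀ (Φ j))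
          (fun τ => inner ℝ (f τ) (Φ j)) τ - inner ℝ u₀ (Φ j)) t := by
      rw [conv, conv, conv, ← intervalIntegral.integral_sub]
      · refine intervalIntegral.integral_congr fun τ hτ => ?_
        simp only [inner_sub_left, hw0]
        rw [hmode τ hτ]
        ring
      · exact hk.mul_continuousOn
          (((hw.mono hsub).sub continuousOn_const).inner continuousOn_const)
      · exact hk.mul_continuousOn (hmc.sub continuousOn_const)
    have hfj : IntervalIntegrable (fun τ => inner ℝ (f τ) (Φ j)) volume 0 t :=
      intervalIntegrable_of_integrableOn_Ioo (hfi.inner_const (𝕜 := ℝ) (Φ j)) ht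
    have hi1 : IntervalIntegrable (fun τ => inner ℝ (w τ) (Φ j)) volume 0 t :=
      (hwc.mono hsub).intervalIntegrable
    have hi2 : IntervalIntegrable (modeSol a (μ j) (inner ℝ u₀ (Φ j))
        fun τ => inner ℝ (f τ) (Φ j)) volume 0 t := hmc.intervalIntegrable
    rw [h3, h1, h2, ← intervalIntegral.integral_sub (hfj.sub (hi1.const_mul _))
      (hfj.sub (hi2.const_mul _)), ← intervalIntegral.integral_const_mul,
      ← intervalIntegral.integral_neg]
    refine intervalIntegral.integral_congr fun τ hτ => ?_
    simp only [inner_sub_left]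
    rw [hmode τ hτ]
    ring
  intro t ht
  refine sub_eq_zero.1 (ext_inner_basis Φ fun j => ?_)
  rw [inner_zero_left]
  exact hzero j ht

/-- The derivative of the solution for `f = f(0) + ∫ f'`, with `d = f(0) - A u₀`. -/
def vecDeriv (a : ℝ) (μ : ℕ → ℝ) (d : H) (f' : ℝ → H) (t : ℝ) : H :=
  diagOp Φ (fun j => relaxKernel a a (μ j) t) d + opConv Φ (fun j => relaxKernel a a (μ j)) f' t

theorem integrableOn_vecDeriv {d : H} {f' : ℝ → H} (ha : 0 < a) (ha1 : a < 1) (hμ : ∀ j, 0 ≤ μ j)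
    (hf' : IntegrableOn f' (Ioo 0 T)) : IntegrableOn (vecDeriv Φ a μ d f') (Ioo 0 T) := by
  refine Integrable.add ?_ ?_
  · refine Integrable.mono' ((integrableOn_rlKernel ha T).mul_const ‖d‖)
      (aestronglyMeasurable_of_inner Φ fun j => ?_) ?_
    · refine ((measurable_relaxKernel ha ha1 ha (μ j)).aestronglyMeasurable.mul_const
        (inner ℝ d (Φ j))).congr ?_
      filter_upwards [ae_restrict_mem measurableSet_Ioo] with t ht
      rw [inner_diagOp Φ fun j => abs_relaxKernel_le ha ha1 (hμ j) ht.1]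
    · filter_upwards [ae_restrict_mem measurableSet_Ioo] with t ht
      exact norm_diagOp_le Φ (fun j => abs_relaxKernel_le ha ha1 (hμ j) ht.1) d
  · exact integrableOn_opConv Φ (fun j => measurable_relaxKernel ha ha1 ha _)
      (fun j => integrableOn_relaxKernel ha ha1 ha _ T)
      (fun r hr j => abs_relaxKernel_le ha ha1 (hμ j) hr.1) (integrableOn_rlKernel ha T) hf'

theorem inner_vecDeriv {d : H} {f' : ℝ → H} (ha : 0 < a) (ha1 : a < 1) (hμ : ∀ j, 0 ≤ μ j)
    (hf' : IntegrableOn f' (Ioo 0 T)) :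
    ∀ᵐ t ∂(volume.restrict (Ioo 0 T)), ∀ j, inner ℝ (vecDeriv Φ a μ d f' t) (Φ j) =
      relaxKernel a a (μ j) t * inner ℝ d (Φ j) +
        conv (relaxKernel a a (μ j)) (fun τ => inner ℝ (f' τ) (Φ j)) t := by
  filter_upwards [ae_intervalIntegrable_conv (integrableOn_rlKernel ha T) hf'.norm,
    ae_restrict_mem measurableSet_Ioo] with t h1 ht j
  rw [vecDeriv, inner_add_left, inner_diagOp Φ fun j => abs_relaxKernel_le ha ha1 (hμ j) ht.1,
    (inner_opConv Φ (g := rlKernel a) ht.1.le (fun j => measurable_relaxKernel ha ha1 ha _)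
      (fun r hr j => abs_relaxKernel_le ha ha1 (hμ j) hr.1)
      (hf'.1.mono_measure (Measure.restrict_mono_set _ (Ioo_subset_Ioo_right ht.2.le))) h1 j).2]

/-- The derivative is integrable against the singular kernel at every time: its norm is at most
`t^{a-1} ‖d‖ / Γ(a)` plus the Riemann-Liouville integral of order `a` of `‖f'‖`. -/
theorem intervalIntegrable_rpow_smul_vecDeriv {d : H} {f' : ℝ → H} (ha : 0 < a) (ha1 : a < 1)
    (hμ : ∀ j, 0 ≤ μ j) (hf' : IntegrableOn f' (Ioo 0 T)) {t : ℝ} (ht : t ∈ Icc 0 T) :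
    IntervalIntegrable (fun τ => (t - τ) ^ (-a) • vecDeriv Φ a μ d f' τ) volume 0 t := by
  have hb : 0 < 1 - a := by linarith
  have hG := Real.Gamma_pos_of_pos hb
  have h1 := intervalIntegrable_rlKernel_relaxKernel ha ha1 ha hb 0 ht.1
  have h2 := (conv_rlKernel_conv ha ha1 le_rfl hf'.norm ht).1
  rw [show relaxKernel a a 0 = rlKernel a from funext (relaxKernel_zero a a)] at h1 h2
  have h3 := ((h1.mul_const ‖d‖).add h2).const_mul (Real.Gamma (1 - a))
  rw [intervalIntegrable_iff_integrableOn_Ioo_of_le ht.1] at h3 ⊢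
  have hsub : Ioo 0 t ⊆ Ioo 0 T := Ioo_subset_Ioo_right ht.2
  refine Integrable.mono' h3 ?_ ?_
  · refine AEStronglyMeasurable.smul ?_ (((integrableOn_vecDeriv Φ ha ha1 hμ hf').mono_set hsub).1)
    exact ((measurable_const.sub measurable_id).pow_const _).aestronglyMeasurable
  · filter_upwards [ae_restrict_of_ae_restrict_of_subset hsub
      (ae_intervalIntegrable_conv (integrableOn_rlKernel ha T) hf'.norm),
      ae_restrict_mem measurableSet_Ioo] with τ h hτ
    have hp : (t - τ) ^ (-a) = Real.Gamma (1 - a) * rlKernel (1 - a) (t - τ) := by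
      rw [rlKernel, show 1 - a - 1 = -a by ring]
      field_simp
    have hpos := rlKernel_nonneg hb (sub_mem_Ioo hτ).1.le
    rw [norm_smul, Real.norm_of_nonneg (Real.rpow_nonneg (sub_mem_Ioo hτ).1.le _), hp, mul_assoc,
      mul_assoc, ← mul_add]
    refine mul_le_mul_of_nonneg_left (mul_le_mul_of_nonneg_left ?_ hpos) hG.le
    refine (norm_add_le _ _).trans (add_le_add ?_ ?_)
    · exact norm_diagOp_le Φ (fun j => abs_relaxKernel_le ha ha1 (hμ j) hτ.1) d
    · exact norm_opConv_le Φ hτ.1.le (fun r hr j => abs_relaxKernel_le ha ha1 (hμ j) hr.1) h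

/-- The solution is the primitive of `vecDeriv`, as its modes are the primitives of `modeDeriv`. -/
theorem eq_add_integral_vecDeriv {d : H} {f' w : ℝ → H} (ha : 0 < a) (ha1 : a < 1)
    (hμ : ∀ j, 0 ≤ μ j) (hf' : IntegrableOn f' (Ioo 0 T))
    (hf : ∀ t ∈ Icc 0 T, f t = f 0 + ∫ τ in (0 : ℝ)..t, f' τ)
    (hd : ∀ j, inner ℝ d (Φ j) = inner ℝ (f 0) (Φ j) - μ j * inner ℝ u₀ (Φ j))
    (hmode : ∀ t ∈ Icc 0 T, ∀ j, inner ℝ (w t) (Φ j) =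
      modeSol a (μ j) (inner ℝ u₀ (Φ j)) (fun τ => inner ℝ (f τ) (Φ j)) t)
    {t : ℝ} (ht : t ∈ Icc 0 T) :
    w t = u₀ + ∫ τ in (0 : ℝ)..t, vecDeriv Φ a μ d f' τ := by
  refine ext_inner_basis Φ fun j => ?_
  rw [inner_add_left, inner_intervalIntegral (intervalIntegrable_of_integrableOn_Ioo
    (integrableOn_vecDeriv Φ ha ha1 hμ hf') ht),
    integral_congr_Ioo ((inner_vecDeriv Φ ha ha1 hμ hf').mono fun τ h => h j) ht, hmode t ht,
    ← integral_modeDeriv (f₀ := inner ℝ (f 0) (Φ j)) (inner ℝ u₀ (Φ j)) ha ha1 (hμ j)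
      (hf'.inner_const (𝕜 := ℝ) (Φ j)) (inner_primitive hf' hf (Φ j)) ht]
  simp only [modeDeriv, hd]

theorem ae_hasDerivAt_of_eq_integral {E : Type*} [NormedAddCommGroup E] [NormedSpace ℝ E]
    [CompleteSpace E] {w y : ℝ → E} {c : E} {T : ℝ} (hT : 0 ≤ T) (hy : IntegrableOn y (Ioo 0 T))
    (hw : ∀ t ∈ Icc 0 T, w t = c + ∫ τ in (0 : ℝ)..t, y τ) :
    ∀ᵐ t ∂(volume.restrict (Ioo 0 T)), HasDerivAt w (y t) t := by
  have hyi := intervalIntegrable_of_integrableOn_Ioo hy ⟨hT, le_rfl⟩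
  rw [ae_restrict_iff' measurableSet_Ioo]
  filter_upwards [hyi.ae_hasDerivAt_integral] with t h ht
  have ht' : t ∈ uIcc 0 T := by
    rw [uIcc_of_le hT]; exact Ioo_subset_Icc_self ht
  have h1 := (h ht' 0 (by simp)).const_add c
  refine h1.congr_of_eventuallyEq ?_
  filter_upwards [Icc_mem_nhds ht.1 ht.2] with r hr using hw r hr

/-- The equation at every positive time, with the Caputo derivative given by the integral of the
classical derivative. -/
theorem caputoIntegral_of_modes {d : H} {f' w : ℝ → H} (ha : 0 < a) (ha1 : a < 1)
    (hμ : ∀ j, 0 ≤ μ j) (hf' : IntegrableOn f' (Ioo 0 T))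
    (hf : ∀ t ∈ Icc 0 T, f t = f 0 + ∫ τ in (0 : ℝ)..t, f' τ)
    (hd : ∀ j, inner ℝ d (Φ j) = inner ℝ (f 0) (Φ j) - μ j * inner ℝ u₀ (Φ j))
    (hmode : ∀ t ∈ Icc 0 T, ∀ j, inner ℝ (w t) (Φ j) =
      modeSol a (μ j) (inner ℝ u₀ (Φ j)) (fun τ => inner ℝ (f τ) (Φ j)) t)
    (hderiv : ∀ᵐ t ∂(volume.restrict (Ioo 0 T)), deriv w t = vecDeriv Φ a μ d f' t)
    {t : ℝ} (ht : t ∈ Ioc 0 T) :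
    IntervalIntegrable (fun τ => (t - τ) ^ (-a) • deriv w τ) volume 0 t ∧
    ∀ j, inner ℝ (caputoIntegral a w t) (Φ j) + μ j * inner ℝ (w t) (Φ j) =
      inner ℝ (f t) (Φ j) := by
  have ht' := Ioc_subset_Icc_self ht
  have hi : IntervalIntegrable (fun τ => (t - τ) ^ (-a) • deriv w τ) volume 0 t := by
    have h := intervalIntegrable_rpow_smul_vecDeriv (d := d) Φ ha ha1 hμ hf' ht'
    rw [intervalIntegrable_iff_integrableOn_Ioo_of_le ht'.1] at h ⊢
    refine Integrable.congr h ?_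
    filter_upwards [ae_restrict_of_ae_restrict_of_subset (Ioo_subset_Ioo_right ht.2) hderiv]
      with τ hτ
    rw [hτ]
  refine ⟨hi, fun j => ?_⟩
  have he : -a = 1 - a - 1 := by ring
  have h1 : inner ℝ (caputoIntegral a w t) (Φ j) =
      conv (rlKernel (1 - a)) (fun τ => inner ℝ (deriv w τ) (Φ j)) t := by
    rw [← inner_fracIntegral (by rwa [← he])]
    rw [caputoIntegral, fracIntegral, he]
  have h2 : conv (rlKernel (1 - a)) (fun τ => inner ℝ (deriv w τ) (Φ j)) t =
      conv (rlKernel (1 - a)) (modeDeriv a (μ j) (inner ℝ u₀ (Φ j)) (inner ℝ (f 0) (Φ j))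
        fun τ => inner ℝ (f' τ) (Φ j)) t := by
    refine integral_congr_Ioo ?_ ⟨ht'.1, le_rfl⟩
    have hsub : Ioo 0 t ⊆ Ioo 0 T := Ioo_subset_Ioo_right ht.2
    filter_upwards [ae_restrict_of_ae_restrict_of_subset hsub hderiv,
      ae_restrict_of_ae_restrict_of_subset hsub (inner_vecDeriv (d := d) Φ ha ha1 hμ hf')]
      with τ h3 h4
    rw [h3, h4, modeDeriv, hd]
  rw [h1, h2, hmode t ht']
  exact conv_rlKernel_modeDeriv (inner ℝ u₀ (Φ j)) ha ha1 (hμ j)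
    (hf'.inner_const (𝕜 := ℝ) (Φ j)) (inner_primitive hf' hf (Φ j)) ht

end Abstract

/-! ### The fractional Laplacian as a diagonal operator -/

section Laplacian

variable {N : ℕ} {Ω : Set (EuclideanSpace ℝ (Fin N))} {lam : ℕ → ℝ} {Φ : HilbertBasis ℕ ℝ (L2 Ω)}
  {s : ℝ}

theorem mem_fracDomain_iff (hpos : ∀ j, 0 < lam j) {x : L2 Ω} :
    x ∈ fracDomain lam Φ s ↔ Summable fun j => (lam j ^ s * inner ℝ x (Φ j)) ^ 2 := by
  refine summable_congr fun j => ?_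
  rw [mul_pow, sq_abs, mul_comm 2 s, ← Real.rpow_mul_natCast (hpos j).le]
  norm_num

theorem inner_fracLaplacian (hpos : ∀ j, 0 < lam j) {x : L2 Ω} (hx : x ∈ fracDomain lam Φ s)
    (j : ℕ) : inner ℝ (fracLaplacian lam Φ s x) (Φ j) = lam j ^ s * inner ℝ x (Φ j) :=
  inner_diagOp_of_summable Φ ((mem_fracDomain_iff hpos).1 hx) j

theorem fracLaplacian_eq (hpos : ∀ j, 0 < lam j) {x y : L2 Ω}
    (h : ∀ j, inner ℝ y (Φ j) = lam j ^ s * inner ℝ x (Φ j)) :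
    x ∈ fracDomain lam Φ s ∧ fracLaplacian lam Φ s x = y := by
  refine ⟨(mem_fracDomain_iff hpos).2 ?_, diagOp_eq Φ h⟩
  simpa only [h] using (hasSum_inner_sq Φ y).summable

theorem exists_ae_norm_le {E : Type*} [NormedAddCommGroup E] {f : ℝ → E} {ν : Measure ℝ}
    (hf : MemLp f ⊤ ν) : ∃ M, ∀ᵐ t ∂ν, ‖f t‖ ≤ M := by
  refine ⟨(eLpNorm f ⊤ ν).toReal, ?_⟩
  rw [eLpNorm_exponent_top]
  filter_upwards [ae_le_eLpNormEssSup (f := f) (μ := ν)] with t ht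
  have h := hf.2
  rw [eLpNorm_exponent_top] at h
  have := ENNReal.toReal_mono h.ne ht
  simpa using this

/-- As the eigenvalues are bounded below, `F` is bounded in `L²(Ω)` if `(-Δ)^s F` is. -/
theorem bounded_of_memLpDomain {T : ℝ} {F : ℝ → L2 Ω} (hpos : ∀ j, 0 < lam j)
    (hmono : Monotone lam) (hs : 0 < s) (hF : MemLpDomain lam Φ s T ⊤ F) :
    AEStronglyMeasurable F (volume.restrict (Ioo 0 T)) ∧
      ∃ M, ∀ᵐ t ∂(volume.restrict (Ioo 0 T)), ‖F t‖ ≤ M := by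
  have hp : ∀ j, 0 < lam j ^ s := fun j => Real.rpow_pos_of_pos (hpos j) s
  have hb : ∀ j, |(lam j ^ s)⁻¹| ≤ (lam 0 ^ s)⁻¹ := fun j => by
    rw [abs_of_pos (inv_pos.2 (hp j))]
    exact inv_anti₀ (hp 0) (Real.rpow_le_rpow (hpos 0).le (hmono (Nat.zero_le j)) hs.le)
  have heq : ∀ᵐ t ∂(volume.restrict (Ioo 0 T)),
      diagOp Φ (fun j => (lam j ^ s)⁻¹) (fracLaplacian lam Φ s (F t)) = F t := by
    filter_upwards [hF.1] with t ht
    refine diagOp_eq Φ fun j => ?_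
    rw [inner_fracLaplacian hpos ht, inv_mul_cancel_left₀ (hp j).ne']
  constructor
  · refine aestronglyMeasurable_of_inner Φ fun j => ?_
    refine ((hF.2.1.inner (𝕜 := ℝ) (aestronglyMeasurable_const (b := Φ j))).const_mul
      ((lam j ^ s)⁻¹)).congr ?_
    filter_upwards [hF.1] with t ht
    rw [inner_fracLaplacian hpos ht, inv_mul_cancel_left₀ (hp j).ne']
  · obtain ⟨M, hM⟩ := exists_ae_norm_le hF.2
    refine ⟨(lam 0 ^ s)⁻¹ * M, ?_⟩
    filter_upwards [heq, hM] with t h1 h2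
    rw [← h1]
    exact (norm_diagOp_le Φ hb _).trans
      (mul_le_mul_of_nonneg_left h2 (inv_pos.2 (hp 0)).le)

theorem homTerm_eq (a : ℝ) (u₀ : L2 Ω) (t : ℝ) :
    homTerm lam Φ s a u₀ t =
      fun j => (relaxKernel a 1 (lam j ^ s) t * inner ℝ u₀ (Φ j)) • Φ j := by
  ext1 j
  rw [homTerm, relaxKernel_one]

theorem IsWeakSolution.isWeakSolutionAE {a T : ℝ} {u₀ : L2 Ω} {F u : ℝ → L2 Ω}
    (h : IsWeakSolution lam Φ s a T u₀ F u) : IsWeakSolutionAE lam Φ s a T u₀ F u where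
  continuousOn := h.continuousOn
  memL2 := h.memL2
  equation := by
    obtain ⟨v, hv, -, hv2, heq⟩ := h.equation
    refine ⟨v, hv, hv2, ?_⟩
    filter_upwards [ae_restrict_mem measurableSet_Ioo] with t ht
    exact (heq t (Ioo_subset_Ioc_self ht)).2
  initial := h.initial

end Laplacian

end FracDiff

end

theorem mainTheorem4 {N : ℕ} {Ω : Set (EuclideanSpace ℝ (Fin N))} (hΩ : IsOpen Ω)
    (lam : ℕ → ℝ) (Φ : HilbertBasis ℕ ℝ (FracDiff.L2 Ω))
    (hΦ : FracDiff.IsDirichletEigenbasis Ω lam Φ)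
    (s α T : ℝ) (hs : 0 < s ∧ s < 1) (hα : 0 < α ∧ α < 1) (hT : 0 < T)
    (u₀ : FracDiff.L2 Ω) (hu₀ : u₀ ∈ FracDiff.fracDomain lam Φ s)
    (F : ℝ → FracDiff.L2 Ω) (hF : FracDiff.MemLpDomain lam Φ s T ⊤ F) :
    -- the series is meaningful on `[0,T]`
    (∀ t ∈ Icc (0 : ℝ) T,
      (∀ j, IntervalIntegrable (FracDiff.duhamelIntegrand lam Φ s α F t j) volume 0 t) ∧
      Summable (FracDiff.homTerm lam Φ s α u₀ t) ∧
      Summable (FracDiff.duhamelTerm lam Φ s α F t)) ∧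
    -- it is the unique solution
    FracDiff.IsWeakSolutionAE lam Φ s α T u₀ F (FracDiff.seriesSolution lam Φ s α u₀ F) ∧
    (∀ w : ℝ → FracDiff.L2 Ω, FracDiff.IsWeakSolutionAE lam Φ s α T u₀ F w →
      EqOn w (FracDiff.seriesSolution lam Φ s α u₀ F) (Icc 0 T)) ∧
    -- the equation holds at every time with a continuous derivative, exactly for continuous `F`
    (FracDiff.IsWeakSolution lam Φ s α T u₀ F (FracDiff.seriesSolution lam Φ s α u₀ F) ↔
      ContinuousOn F (Ioc 0 T)) ∧
    (∀ w : ℝ → FracDiff.L2 Ω, FracDiff.IsWeakSolution lam Φ s α T u₀ F w →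
      EqOn w (FracDiff.seriesSolution lam Φ s α u₀ F) (Icc 0 T)) ∧
    -- for absolutely continuous `F` the Caputo derivative is the integral of the derivative
    (∀ F' : ℝ → FracDiff.L2 Ω, IntervalIntegrable F' volume 0 T →
      (∀ t ∈ Icc (0 : ℝ) T, F t = F 0 + ∫ τ in (0 : ℝ)..t, F' τ) →
      (∀ᵐ t ∂(volume.restrict (Ioo 0 T)),
        DifferentiableAt ℝ (FracDiff.seriesSolution lam Φ s α u₀ F) t) ∧
      IntervalIntegrable (deriv (FracDiff.seriesSolution lam Φ s α u₀ F)) volume 0 T ∧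
      (∀ t ∈ Icc (0 : ℝ) T, FracDiff.seriesSolution lam Φ s α u₀ F t =
        u₀ + ∫ τ in (0 : ℝ)..t, deriv (FracDiff.seriesSolution lam Φ s α u₀ F) τ) ∧
      (∀ t ∈ Ioc (0 : ℝ) T,
        IntervalIntegrable
          (fun τ => (t - τ) ^ (-α) • deriv (FracDiff.seriesSolution lam Φ s α u₀ F) τ)
          volume 0 t ∧
        FracDiff.caputoIntegral α (FracDiff.seriesSolution lam Φ s α u₀ F) t +
          FracDiff.fracLaplacian lam Φ s (FracDiff.seriesSolution lam Φ s α u₀ F t) = F t)) := by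
  open FracDiff in
  obtain ⟨ha, ha1⟩ := hα
  have hpos := hΦ.pos
  have hμ : ∀ j, 0 ≤ lam j ^ s := fun j => (Real.rpow_pos_of_pos (hpos j) s).le
  obtain ⟨hFm, M, hM⟩ := bounded_of_memLpDomain hpos hΦ.mono hs.1 hF
  have hFi : IntegrableOn F (Ioo 0 T) := Integrable.of_bound hFm M hM
  have hgm := hF.2.1
  obtain ⟨M', hM'⟩ := exists_ae_norm_le hF.2
  set u := seriesSolution lam Φ s α u₀ F with hu
  -- the series is `S(t)u₀ + ∫ K(t-τ)F(τ)dτ`, with modes solving the scalar equations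
  have hduh : ∀ t ∈ Icc 0 T, ∀ j, duhamelTerm lam Φ s α F t j =
      inner ℝ (opConv Φ (fun j => relaxKernel α α (lam j ^ s)) F t) (Φ j) • Φ j := by
    intro t ht j
    rw [(inner_opConv_relaxKernel Φ ha ha1 hμ hFm hM ht j).2]
    rfl
  have huv : ∀ t ∈ Icc 0 T, u t = vecSol Φ α (fun j => lam j ^ s) u₀ F t := by
    intro t ht
    rw [hu, seriesSolution, vecSol, homTerm_eq, funext (hduh t ht), (hasSum_inner_smul Φ _).tsum_eq]
    rfl
  have hmode : ∀ t ∈ Icc 0 T, ∀ j, inner ℝ (u t) (Φ j) =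
      modeSol α (lam j ^ s) (inner ℝ u₀ (Φ j)) (fun τ => inner ℝ (F τ) (Φ j)) t := by
    intro t ht j
    rw [huv t ht, inner_vecSol Φ ha ha1 hμ hFm hM ht]
  have huc : ContinuousOn u (Icc 0 T) :=
    (continuousOn_vecSol Φ ha ha1 hμ hFm hM).congr huv
  have hu0 : u 0 = u₀ := ext_inner_basis Φ fun j => by
    rw [hmode 0 ⟨le_rfl, hT.le⟩, modeSol_zero ha]
  -- `(-Δ)^s u` is the solution with data `(-Δ)^s u₀` and `(-Δ)^s F`
  set G := vecSol Φ α (fun j => lam j ^ s) (fracLaplacian lam Φ s u₀)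
    (fun τ => fracLaplacian lam Φ s (F τ)) with hG
  have hGc : ContinuousOn G (Icc 0 T) := continuousOn_vecSol Φ ha ha1 hμ hgm hM'
  have hlap : ∀ t ∈ Icc 0 T, u t ∈ fracDomain lam Φ s ∧ fracLaplacian lam Φ s (u t) = G t := by
    intro t ht
    refine fracLaplacian_eq hpos fun j => ?_
    rw [hG, inner_vecSol Φ ha ha1 hμ hgm hM' ht, hmode t ht, modeSol, modeSol,
      inner_fracLaplacian hpos hu₀]
    have : conv (relaxKernel α α (lam j ^ s))
        (fun τ => inner ℝ (fracLaplacian lam Φ s (F τ)) (Φ j)) t =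
        lam j ^ s * conv (relaxKernel α α (lam j ^ s)) (fun τ => inner ℝ (F τ) (Φ j)) t := by
      rw [conv, conv, ← intervalIntegral.integral_const_mul]
      refine integral_congr_Ioo ?_ ⟨ht.1, le_rfl⟩
      filter_upwards [ae_restrict_of_ae_restrict_of_subset (Ioo_subset_Ioo_right ht.2) hF.1]
        with τ hτ
      rw [inner_fracLaplacian hpos hτ]
      ring
    rw [this]
    ring
  have hGi : IntegrableOn G (Ioo 0 T) :=
    hGc.integrableOn_Icc.mono_set Ioo_subset_Icc_self
  have hGmem : ∀ p, MemLp G p (volume.restrict (Ioo 0 T)) := by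
    intro p
    obtain ⟨C, hC⟩ := isCompact_Icc.exists_bound_of_continuousOn hGc
    refine MemLp.of_bound hGi.1 C ?_
    filter_upwards [ae_restrict_mem measurableSet_Ioo] with t ht
    exact hC t (Ioo_subset_Icc_self ht)
  have hlapG : (fun t => fracLaplacian lam Φ s (u t)) =ᵐ[volume.restrict (Ioo 0 T)] G := by
    filter_upwards [ae_restrict_mem measurableSet_Ioo] with t ht
    exact (hlap t (Ioo_subset_Icc_self ht)).2
  have hmem : MemLpDomain lam Φ s T 2 u := by
    refine ⟨?_, (memLp_congr_ae hlapG).2 (hGmem 2)⟩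
    filter_upwards [ae_restrict_mem measurableSet_Ioo] with t ht
    exact (hlap t (Ioo_subset_Icc_self ht)).1
  have hinit : Tendsto (fun t => ‖u t - u₀‖) (𝓝[>] 0) (𝓝 0) := by
    have h := (huc 0 ⟨le_rfl, hT.le⟩).mono_left
      (nhdsWithin_mono 0 (Ioo_subset_Icc_self (a := 0) (b := T)))
    rw [nhdsWithin_Ioo_eq_nhdsGT hT, hu0] at h
    exact tendsto_iff_norm_sub_tendsto_zero.1 h
  set v : ℝ → L2 Ω := fun t => F t - fracLaplacian lam Φ s (u t) with hv
  have hvmem : MemLp v 2 (volume.restrict (Ioo 0 T)) :=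
    (MemLp.of_bound hFm M hM).sub hmem.2
  have hvi : IntegrableOn v (Ioo 0 T) :=
    hFi.sub (hGi.congr hlapG.symm)
  have hcap : HasCaputoDeriv α T u v := by
    refine hasCaputoDeriv_of_modes Φ ha ha1 hμ hFi huc hmode hvi ?_ hT.le
    filter_upwards [ae_restrict_mem measurableSet_Ioo] with t ht j
    rw [hv]
    simp only [inner_sub_left]
    rw [inner_fracLaplacian hpos (hlap t (Ioo_subset_Icc_self ht)).1]
  have hsol : IsWeakSolutionAE lam Φ s α T u₀ F u :=
    ⟨huc, hmem, ⟨v, hcap, hvmem, Eventually.of_forall fun t => sub_add_cancel _ _⟩, hinit⟩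
  have huniq : ∀ w : ℝ → L2 Ω, IsWeakSolutionAE lam Φ s α T u₀ F w → EqOn w u (Icc 0 T) := by
    intro w hw
    obtain ⟨v', hv', -, heq⟩ := hw.equation
    have hw0 : w 0 = u₀ := by
      have h := (hw.continuousOn 0 ⟨le_rfl, hT.le⟩).mono_left
        (nhdsWithin_mono 0 (Ioo_subset_Icc_self (a := 0) (b := T)))
      rw [nhdsWithin_Ioo_eq_nhdsGT hT] at h
      exact tendsto_nhds_unique h (tendsto_iff_norm_sub_tendsto_zero.2 hw.initial)
    have h := eqOn_vecSol_of_hasCaputoDeriv Φ ha ha1 hμ hT hFm hM hw.continuousOn hw0 hv' ?_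
    · exact fun t ht => (h ht).trans (huv t ht).symm
    · filter_upwards [heq, hw.memL2.1] with t h1 h2 j
      rw [← h1, inner_add_left, inner_fracLaplacian hpos h2, add_sub_cancel_right]
  refine ⟨fun t ht => ⟨fun j => ?_, ?_, ?_⟩, hsol, huniq, ⟨fun h => ?_, fun h => ?_⟩,
    fun w hw => huniq w hw.isWeakSolutionAE, fun F' hF' hFF' => ?_⟩
  · exact (inner_opConv_relaxKernel Φ ha ha1 hμ hFm hM ht j).1
  · rw [homTerm_eq]
    exact summable_diagOp Φ (fun j => abs_relaxKernel_one_le ha ha1 (hμ j) ht.1) u₀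
  · rw [funext (hduh t ht)]
    exact (hasSum_inner_smul Φ _).summable
  · obtain ⟨v', -, hvc, -, heq⟩ := h.equation
    refine (hvc.add (hGc.mono Ioc_subset_Icc_self)).congr fun t ht => ?_
    rw [← (heq t ht).2, (hlap t (Ioc_subset_Icc_self ht)).2]
    rfl
  · refine ⟨huc, hmem, ⟨v, hcap, ?_, hvmem, fun t ht =>
      ⟨(hlap t (Ioc_subset_Icc_self ht)).1, sub_add_cancel _ _⟩⟩, hinit⟩
    refine (h.sub (hGc.mono Ioc_subset_Icc_self)).congr fun t ht => ?_
    rw [hv]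
    simp only
    rw [(hlap t (Ioc_subset_Icc_self ht)).2]
    rfl
  · have hF'i : IntegrableOn F' (Ioo 0 T) :=
      (intervalIntegrable_iff_integrableOn_Ioo_of_le hT.le).1 hF'
    set d : L2 Ω := F 0 - fracLaplacian lam Φ s u₀ with hd
    have hdj : ∀ j, inner ℝ d (Φ j) =
        inner ℝ (F 0) (Φ j) - lam j ^ s * inner ℝ u₀ (Φ j) := fun j => by
      rw [hd, inner_sub_left, inner_fracLaplacian hpos hu₀]
    have hint : ∀ t ∈ Icc 0 T, u t = u₀ + ∫ τ in (0 : ℝ)..t,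
        vecDeriv Φ α (fun j => lam j ^ s) d F' τ := fun t ht =>
      eq_add_integral_vecDeriv Φ ha ha1 hμ hF'i hFF' hdj hmode ht
    have hyi := integrableOn_vecDeriv Φ (d := d) ha ha1 hμ hF'i
    have hder := ae_hasDerivAt_of_eq_integral hT.le hyi hint
    have hder' : ∀ᵐ t ∂(volume.restrict (Ioo 0 T)),
        deriv u t = vecDeriv Φ α (fun j => lam j ^ s) d F' t := hder.mono fun t h => h.deriv
    refine ⟨hder.mono fun t h => h.differentiableAt,
      intervalIntegrable_of_integrableOn_Ioo (Integrable.congr hyi (hder'.mono fun t h => h.symm))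
        ⟨hT.le, le_rfl⟩, fun t ht => ?_, fun t ht => ?_⟩
    · rw [hint t ht, integral_congr_Ioo hder' ht]
    · obtain ⟨h1, h2⟩ := caputoIntegral_of_modes Φ ha ha1 hμ hF'i hFF' hdj hmode hder' ht
      refine ⟨h1, ext_inner_basis Φ fun j => ?_⟩
      rw [inner_add_left, inner_fracLaplacian hpos (hlap t (Ioc_subset_Icc_self ht)).1, h2]
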